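/- Let $n\ge 1$ and let $\mathfrak S_n$ be the symmetric group with simple transpositions $S=\{s_1,\dots,s_{n-1}\}$, $s_i=(i,i+1)$, products being composed as functions, $(xy)(i)=x(y(i))$. Let $\ell(x)$ be the number of inversions of $x$. The Bruhat graph has an edge $x\to y$ whenever $y=xt$ for some transposition $t$ and $\ell(x)<\ell(y)$; the Bruhat order is $x\le y$ iff there is a directed path from $x$ to $y$, and $[x,y]=\{w: x\le w\le y\}$. For $x\le y$ let $d(x,y)$ be the minimal length (number of edges) of a directed path from $x$ to $y$. For $u\le v$ and $z\in[u,v]$, the set $W^z_{[u,v]}$ of shortcuts for $[u,v]$ with respect to $z$ consists of all $p\in[z,v]$ such that every path from $u$ to $p$ of length $d(u,p)$ meets $[z,v]$ only in $p$. Write $z\vee x$ for the minimum of $[z,v]\cap[x,v]$, if it exists. If $z'\vee x$ exists for all $x\in[u,v]$, then $DS(z,z')$ denotes the multiset $$DS(z,z')=\{(d(u,p)+d(p,b),\,b)\;:\;p\in W^{z}_{[u,v]},\ b\in W^{z'\vee p}_{[p,v]}\},$$ with one entry for each such pair $(p,b)$. For $J\subseteq S$ let $W_J$ be the subgroup generated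 by $J$. Theorem. For all $u\le v$ in $\mathfrak S_n$, the minima $$z_n=\min([u,v]\cap W_{S\setminus\{s_{n-1}\}}v),\quad z_1=\min([u,v]\cap W_{S\setminus\{s_1\}}v),\quad z^n=\min([u,v]\cap vW_{S\setminus\{s_{n-1}\}}),\quad z^1=\min([u,v]\cap vW_{S\setminus\{s_1\}})$$ in the Bruhat order exist (for $n=1$ all four are $\min[u,v]$), for each of them, $z$ say, $z\vee x$ exists for all $x\in[u,v]$, and $$DS(z_n,z_1)=DS(z_1,z_n),\quad DS(z^n,z^1)=DS(z^1,z^n),\quad DS(z_n,z^n)=DS(z^n,z_n),\quad DS(z^1,z_1)=DS(z_1,z^1)$$ as multisets. -/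

import Mathlib

namespace SymBruhat

open Equiv (Perm)

/-! The symmetric group `S_n` is `Perm (Fin n)`; the letters `1, …, n` are the elements
`0, …, n - 1` of `Fin n`, and `(x * y) i = x (y i)`. -/

/-- The Coxeter length of a permutation: its number of inversions. -/
def length {n : ℕ} (x : Perm (Fin n)) : ℕ :=
  (Finset.univ.filter fun e : Fin n × Fin n => e.1 < e.2 ∧ x e.2 < x e.1).card

/-- The edges `x → y` of the Bruhat graph: `y = x t` for a transposition `t`, and
`ℓ(x) < ℓ(y)`. -/
def Edge {n : ℕ} (x y : Perm (Fin n)) : Prop :=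
  (∃ i j : Fin n, i ≠ j ∧ y = x * Equiv.swap i j) ∧ length x < length y

/-- The Bruhat order: `x ≤ y` when there is a directed path from `x` to `y` in the
Bruhat graph. -/
def BruhatLE {n : ℕ} (x y : Perm (Fin n)) : Prop :=
  Relation.ReflTransGen Edge x y

/-- The Bruhat interval `[x, y]`. -/
def interval {n : ℕ} (x y : Perm (Fin n)) : Set (Perm (Fin n)) :=
  {w | BruhatLE x w ∧ BruhatLE w y}

/-- `m` is the minimum of `A` in the Bruhat order. -/
def IsMinimum {n : ℕ} (A : Set (Perm (Fin n))) (m : Perm (Fin n)) : Prop :=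
  m ∈ A ∧ ∀ x ∈ A, BruhatLE m x

/-- A (directed) Bruhat path `x_0 → x_1 → ⋯ → x_r`; its length is `r`. -/
abbrev Path (n : ℕ) : Type :=
  RelSeries {e : Perm (Fin n) × Perm (Fin n) | Edge e.1 e.2}

/-- `γ` is a path from `x` to `y`. -/
def Path.Joins {n : ℕ} (γ : Path n) (x y : Perm (Fin n)) : Prop :=
  γ.head = x ∧ γ.last = y

/-- The support of a path: the set of its vertices. -/
def Path.supp {n : ℕ} (γ : Path n) : Set (Perm (Fin n)) :=
  Set.range γ.toFun

/-- The distance `d(x, y)`: the minimal length of a path from `x` to `y` in the Bruhat graph.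
(It is used only when `x ≤ y`, where such a path exists.) -/
noncomputable def dist {n : ℕ} (x y : Perm (Fin n)) : ℕ :=
  sInf {r | ∃ γ : Path n, γ.Joins x y ∧ γ.length = r}

/-- The set `W^z_{[u,v]}` of shortcuts for `[u, v]` with respect to `z`. -/
def shortcuts {n : ℕ} (u v z : Perm (Fin n)) : Set (Perm (Fin n)) :=
  {p | p ∈ interval z v ∧
    ∀ γ : Path n, γ.Joins u p → γ.length = dist u p → γ.supp ∩ interval z v = {p}}

/-- `m = z ∨ x` relative to the upper bound `v`: the minimum of `[z, v] ∩ [x, v]`. -/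
def IsJoin {n : ℕ} (v z x m : Perm (Fin n)) : Prop :=
  IsMinimum (interval z v ∩ interval x v) m

open scoped Classical in
/-- The multiset `DS(z, z')` of double shortcuts for `[u, v]`: the pairs
`(d(u, p) + d(p, b), b)`, one for each pair `(p, b)` with `p ∈ W^z_{[u,v]}` and
`b ∈ W^{z' ∨ p}_{[p,v]}`. -/
noncomputable def DS {n : ℕ} (u v z z' : Perm (Fin n)) : Multiset (ℕ × Perm (Fin n)) :=
  (Finset.univ.filter fun e : Perm (Fin n) × Perm (Fin n) =>
      e.1 ∈ shortcuts u v z ∧ ∃ m, IsJoin v z' e.1 m ∧ e.2 ∈ shortcuts e.1 v m).val.map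
    fun e => (dist u e.1 + dist e.1 e.2, e.2)

/-- The maximal parabolic subgroup `W_{S ∖ {s_k}}`, `S = {s_1, …, s_{n-1}}`, where `s_i`
exchanges the letters `i` and `i + 1` (the elements `i - 1` and `i` of `Fin n`). -/
def parabolic (n k : ℕ) : Subgroup (Perm (Fin n)) :=
  Subgroup.closure {s | ∃ i j : Fin n, (i : ℕ) + 1 = j ∧ (j : ℕ) ≠ k ∧ s = Equiv.swap i j}

/-- `z = min ([u, v] ∩ W_{S ∖ {s_k}} v)`: the element `z_n` for `k = n - 1` and `z_1` for
`k = 1`. -/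
def IsLowerStandard {n : ℕ} (k : ℕ) (u v z : Perm (Fin n)) : Prop :=
  IsMinimum (interval u v ∩ {x | ∃ w ∈ parabolic n k, x = w * v}) z

/-- `z = min ([u, v] ∩ v W_{S ∖ {s_k}})`: the element `z^n` for `k = n - 1` and `z^1` for
`k = 1`. -/
def IsUpperStandard {n : ℕ} (k : ℕ) (u v z : Perm (Fin n)) : Prop :=
  IsMinimum (interval u v ∩ {x | ∃ w ∈ parabolic n k, x = v * w}) z

/-- The join `z ∨ x` exists for every `x ∈ [u, v]`, so that double shortcuts involving `z` are
defined. -/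
def HasJoins {n : ℕ} (u v z : Perm (Fin n)) : Prop :=
  ∀ x ∈ interval u v, ∃ m, IsJoin v z x m

end SymBruhat

namespace SymBruhat

open Equiv (Perm)

/-! ### Edges of the Bruhat graph -/

section Edges

variable {n : ℕ}

/-! Inversion and conjugation by the longest element are automorphisms of the Bruhat graph. Through
them all four minima become one kind: the minimum of the elements of `[u, v]` that have the same
last letter as `v` (`IsLastMin`). Such minima are reached greedily, and the joins `z ∨ x` are minima
of the same kind for `[x, v]`.

The shortcuts for such a minimum are explicit (`IsLastMin.mem_shortcuts_iff`). They are the `p ≤ v`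
with the last letter of `v` that are reached from `u` by a chain: the last letter is exchanged with
smaller letters at positions moving strictly to the left. Any walk can be rearranged, without
changing its length, so that it starts with a chain and then keeps the last letter
(`Walk.exists_chain`). Conversely, chains are shortest walks, and a shortest walk to the end of a
chain cannot finish with a step that keeps the last letter; both facts are dimension counts in the
span of the vectors `e_i - e_j`.

Summing over chains with weight `q ^ length` is a product of operators `1 + q R`, one for each
position, where `R` is a length-increasing transposition. A double shortcut multiset is therefore a
composite of two such products with restrictions to prescribed letters (`DS_eq_doubleSum`), and each
equality of multisets is a commutation statement.

For the pair of first and last position, the operators satisfy Yang–Baxter relations and the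
restrictions can be moved past all operators but one (`doubleSum_revConj`). For a left and a right
minimum, the chain operator is, up to a cyclic relabelling, a product of Hecke algebra generators
acting on one side. Left and right actions commute, and the relabelling turns out to produce exactly
the required restriction (`doubleSum_inv`). The remaining two equalities follow by applying an
automorphism. -/

theorem length_lt_length_mul_swap {x : Perm (Fin n)} {i j : Fin n} (hij : i < j)
    (hx : x i < x j) : length x < length (x * Equiv.swap i j) := by
  classical
  set t : Perm (Fin n) := Equiv.swap i j with ht
  have htt : ∀ a, t (t a) = a := fun a => Equiv.swap_apply_self i j a
  have hti : t i = j := Equiv.swap_apply_left i j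
  have htj : t j = i := Equiv.swap_apply_right i j
  have htn : ∀ a, a ≠ i → a ≠ j → t a = a := fun a h1 h2 => Equiv.swap_apply_of_ne_of_ne h1 h2
  set g : Fin n × Fin n → Fin n × Fin n := fun e => if t e.1 < t e.2 then (t e.1, t e.2) else e
    with hg
  unfold length
  rw [← Finset.card_image_of_injOn (f := g)]
  · apply Finset.card_lt_card
    rw [Finset.ssubset_iff_of_subset]
    · refine ⟨(i, j), Finset.mem_filter.2 ⟨Finset.mem_univ _, hij, ?_⟩, ?_⟩
      · simpa [hti, htj] using hx
      · rw [Finset.mem_image]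
        rintro ⟨⟨a, b⟩, hab, h⟩
        simp only [Finset.mem_filter, Finset.mem_univ, true_and] at hab
        simp only [hg] at h
        split_ifs at h with h1
        · obtain ⟨h2, h3⟩ := Prod.mk.inj h
          have h4 : a = j := by rw [← htt a, h2, hti]
          have h5 : b = i := by rw [← htt b, h3, htj]
          subst h4 h5
          exact absurd hab.1 hij.not_gt
        · obtain ⟨rfl, rfl⟩ := Prod.mk.inj h
          exact absurd hab.2 hx.not_gt
    · intro e he
      rw [Finset.mem_image] at he
      obtain ⟨⟨a, b⟩, hab, rfl⟩ := he
      simp only [Finset.mem_filter, Finset.mem_univ, true_and] at hab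
      obtain ⟨hab, hba⟩ := hab
      simp only [hg]
      split_ifs with h1
      · refine Finset.mem_filter.2 ⟨Finset.mem_univ _, h1, ?_⟩
        simpa [htt] using hba
      · refine Finset.mem_filter.2 ⟨Finset.mem_univ _, hab, ?_⟩
        rw [Perm.mul_apply, Perm.mul_apply]
        by_cases ha : a = i
        · subst ha
          by_cases hb : b = j
          · subst hb
            exact absurd hba hx.not_gt
          · rw [hti, htn b hab.ne' hb]
            exact hba.trans hx
        · by_cases hb : b = j
          · subst hb
            rw [htj, htn a ha hab.ne]
            exact hx.trans hba
          · exfalso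
            by_cases ha' : a = j
            · subst ha'
              rw [htj, htn b (hij.trans hab).ne' hb] at h1
              exact h1 (hij.trans hab)
            · by_cases hb' : b = i
              · subst hb'
                rw [hti, htn a ha ha'] at h1
                exact h1 (hab.trans hij)
              · rw [htn a ha ha', htn b hb' hb] at h1
                exact h1 hab
  · rintro ⟨a, b⟩ hab ⟨c, d⟩ hcd h
    simp only [Finset.coe_filter, Finset.mem_univ, true_and, Set.mem_ofPred_eq] at hab hcd
    simp only [hg] at h
    split_ifs at h with h1 h2 h2
    · obtain ⟨h3, h4⟩ := Prod.mk.inj h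
      rw [t.injective h3, t.injective h4]
    · obtain ⟨rfl, rfl⟩ := Prod.mk.inj h
      rw [htt, htt] at h2
      exact absurd hab.1 h2
    · obtain ⟨rfl, rfl⟩ := Prod.mk.inj h
      rw [htt, htt] at h1
      exact absurd hcd.1 h1
    · exact h

theorem edge_mul_swap {x : Perm (Fin n)} {i j : Fin n} (hij : i < j) (hx : x i < x j) :
    Edge x (x * Equiv.swap i j) :=
  ⟨⟨i, j, hij.ne, rfl⟩, length_lt_length_mul_swap hij hx⟩

theorem edge_iff {x y : Perm (Fin n)} :
    Edge x y ↔ ∃ i j, i < j ∧ x i < x j ∧ y = x * Equiv.swap i j := by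
  refine ⟨?_, fun ⟨i, j, hij, hx, hy⟩ => hy ▸ edge_mul_swap hij hx⟩
  rintro ⟨⟨i, j, hne, rfl⟩, hl⟩
  wlog hij : i < j generalizing i j
  · rw [Equiv.swap_comm] at hl ⊢
    exact this j i hne.symm hl (lt_of_le_of_ne (not_lt.1 hij) hne.symm)
  refine ⟨i, j, hij, ?_, rfl⟩
  by_contra h
  have h1 : x j < x i := lt_of_le_of_ne (not_lt.1 h) fun h => hne (x.injective h).symm
  have h2 := length_lt_length_mul_swap (x := x * Equiv.swap i j) hij (by simpa using h1)
  rw [mul_assoc, Equiv.swap_mul_self, mul_one] at h2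
  exact absurd hl h2.not_gt

theorem BruhatLE.trans {x y z : Perm (Fin n)} (h : BruhatLE x y) (h' : BruhatLE y z) :
    BruhatLE x z :=
  Relation.ReflTransGen.trans h h'

theorem BruhatLE.refl (x : Perm (Fin n)) : BruhatLE x x :=
  Relation.ReflTransGen.refl

theorem Edge.le {x y : Perm (Fin n)} (h : Edge x y) : BruhatLE x y :=
  Relation.ReflTransGen.single h

end Edges

/-! ### Walks -/

section Walks

variable {n : ℕ}

/-- There is a directed path of length `r` from `x` to `y`. -/
inductive Walk : ℕ → Perm (Fin n) → Perm (Fin n) → Prop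
  | refl (x : Perm (Fin n)) : Walk 0 x x
  | cons {r : ℕ} {x y z : Perm (Fin n)} : Edge x y → Walk r y z → Walk (r + 1) x z

theorem Walk.trans {r s : ℕ} {x y z : Perm (Fin n)} (h : Walk r x y) (h' : Walk s y z) :
    Walk (r + s) x z := by
  induction h with
  | refl => simpa using h'
  | cons e _ ih => rw [Nat.add_right_comm]; exact (ih h').cons e

theorem Edge.walk {x y : Perm (Fin n)} (h : Edge x y) : Walk 1 x y :=
  .cons h (.refl y)

theorem Walk.le {r : ℕ} {x y : Perm (Fin n)} (h : Walk r x y) : BruhatLE x y := by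
  induction h with
  | refl => exact .refl _
  | cons e _ ih => exact e.le.trans ih

theorem BruhatLE.exists_walk {x y : Perm (Fin n)} (h : BruhatLE x y) : ∃ r, Walk r x y := by
  induction h with
  | refl => exact ⟨0, .refl _⟩
  | tail _ e ih =>
    obtain ⟨r, hr⟩ := ih
    exact ⟨_, hr.trans e.walk⟩

theorem Walk.eq_or_exists_last {r : ℕ} {x y : Perm (Fin n)} (h : Walk r x y) :
    r = 0 ∧ x = y ∨ ∃ s w, r = s + 1 ∧ Walk s x w ∧ Edge w y := by
  induction h with
  | refl => exact Or.inl ⟨rfl, rfl⟩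
  | @cons r x y z e h ih =>
    right
    rcases ih with ⟨rfl, rfl⟩ | ⟨s, w, rfl, h1, h2⟩
    · exact ⟨0, x, rfl, .refl x, e⟩
    · exact ⟨s + 1, w, rfl, h1.cons e, h2⟩

theorem Path.walk (γ : Path n) : Walk γ.length γ.head γ.last := by
  induction γ using RelSeries.inductionOn with
  | singleton x => exact .refl x
  | cons γ x hx ih =>
    rw [RelSeries.head_cons, RelSeries.last_cons]
    have : (γ.cons x hx).length = γ.length + 1 := by
      simp [RelSeries.cons, RelSeries.append, add_comm]
    rw [this]
    exact ih.cons hx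

theorem Path.exists_walks {γ : Path n} {y : Perm (Fin n)} (hy : y ∈ γ.supp) :
    ∃ r s, Walk r γ.head y ∧ Walk s y γ.last ∧ r + s = γ.length := by
  obtain ⟨i, rfl⟩ := hy
  have h1 := Path.walk (γ.take i)
  have h2 := Path.walk (γ.drop i)
  rw [RelSeries.head_take, RelSeries.last_take] at h1
  rw [RelSeries.head_drop, RelSeries.last_drop] at h2
  refine ⟨_, _, h1, h2, ?_⟩
  have := i.2
  simp only [RelSeries.take, RelSeries.drop]
  omega

theorem Path.head_mem_supp (γ : Path n) : γ.head ∈ γ.supp := ⟨0, rfl⟩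

theorem Path.last_mem_supp (γ : Path n) : γ.last ∈ γ.supp := ⟨Fin.last _, rfl⟩

theorem Path.supp_subset_cons (γ : Path n) (x : Perm (Fin n)) (h : Edge x γ.head) :
    γ.supp ⊆ Path.supp (γ.cons x h) := by
  intro y hy
  have h1 : y ∈ γ.cons x h := by
    rw [← RelSeries.mem_toList, RelSeries.toList_cons]
    exact List.mem_cons_of_mem _ (RelSeries.mem_toList.2 hy)
  exact h1

theorem Walk.exists_path {r s : ℕ} {x y z : Perm (Fin n)} (h : Walk r x y) (h' : Walk s y z) :
    ∃ γ : Path n, γ.Joins x z ∧ γ.length = r + s ∧ y ∈ γ.supp := by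
  have aux : ∀ {r : ℕ} {x y : Perm (Fin n)} (γ : Path n), Edge x γ.head →
      γ.last = y → γ.length = r → ∃ γ' : Path n, γ'.Joins x y ∧ γ'.length = r + 1 ∧
        γ.supp ⊆ γ'.supp := by
    intro r x y γ hx hy hr
    refine ⟨γ.cons x hx, ⟨RelSeries.head_cons _ _ _, ?_⟩, ?_, Path.supp_subset_cons _ _ _⟩
    · rw [RelSeries.last_cons, hy]
    · simp [RelSeries.cons, RelSeries.append, add_comm, hr]
  induction h with
  | refl x =>
    suffices ∃ γ : Path n, γ.Joins x z ∧ γ.length = s by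
      obtain ⟨γ, h1, h2⟩ := this
      exact ⟨γ, h1, by simpa using h2, h1.1 ▸ γ.head_mem_supp⟩
    induction h' with
    | refl x => exact ⟨RelSeries.singleton _ x, ⟨rfl, rfl⟩, rfl⟩
    | cons e _ ih =>
      obtain ⟨γ, h1, h2⟩ := ih
      obtain ⟨γ', h3, h4, -⟩ := aux γ (h1.1 ▸ e) h1.2 h2
      exact ⟨γ', h3, h4⟩
  | cons e _ ih =>
    obtain ⟨γ, h1, h2, h3⟩ := ih h'
    obtain ⟨γ', h4, h5, h6⟩ := aux γ (h1.1 ▸ e) h1.2 h2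
    exact ⟨γ', h4, by omega, h6 h3⟩

theorem dist_eq_sInf_walk (x y : Perm (Fin n)) : dist x y = sInf {r | Walk r x y} := by
  unfold dist
  congr 1
  ext r
  constructor
  · rintro ⟨γ, ⟨rfl, rfl⟩, rfl⟩
    exact γ.walk
  · intro h
    obtain ⟨γ, h1, h2, -⟩ := (Walk.refl x).exists_path h
    exact ⟨γ, h1, by simpa using h2⟩

theorem BruhatLE.walk_dist {x y : Perm (Fin n)} (h : BruhatLE x y) : Walk (dist x y) x y := by
  rw [dist_eq_sInf_walk]
  exact Nat.sInf_mem (s := {r | Walk r x y}) h.exists_walk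

theorem Walk.dist_le {r : ℕ} {x y : Perm (Fin n)} (h : Walk r x y) : dist x y ≤ r := by
  rw [dist_eq_sInf_walk]
  exact Nat.sInf_le h

/-- A vertex on a shortest path splits it into two walks, so the support of a path need not be
mentioned any more. -/
theorem mem_shortcuts_iff {u v z p : Perm (Fin n)} :
    p ∈ shortcuts u v z ↔ p ∈ interval z v ∧ ∀ y ∈ interval z v, ∀ r s, Walk r u y →
      Walk s y p → r + s = dist u p → y = p := by
  refine and_congr_right fun hp => ⟨?_, ?_⟩
  · intro h y hy r s h1 h2 h3
    obtain ⟨γ, h4, h5, h6⟩ := h1.exists_path h2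
    have h7 : y ∈ γ.supp ∩ interval z v := ⟨h6, hy⟩
    rwa [h γ h4 (h5.trans h3)] at h7
  · rintro h γ ⟨rfl, rfl⟩ hl
    refine Set.eq_singleton_iff_unique_mem.2 ⟨⟨γ.last_mem_supp, hp⟩, ?_⟩
    rintro y ⟨hy, hy'⟩
    obtain ⟨r, s, h1, h2, h3⟩ := Path.exists_walks hy
    exact h y hy' r s h1 h2 (h3.trans hl)

end Walks

/-! ### Automorphisms of the Bruhat graph -/

section Automorphisms

variable {n : ℕ}

/-- A permutation of the vertices of the Bruhat graph that preserves its edges. -/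
def IsAuto (φ : Perm (Perm (Fin n))) : Prop :=
  ∀ x y, Edge (φ x) (φ y) ↔ Edge x y

variable {φ : Perm (Perm (Fin n))}

theorem IsAuto.symm (h : IsAuto φ) : IsAuto φ.symm := fun x y => by
  rw [← h, φ.apply_symm_apply, φ.apply_symm_apply]

theorem IsAuto.trans {ψ : Perm (Perm (Fin n))} (h : IsAuto φ) (h' : IsAuto ψ) :
    IsAuto (φ.trans ψ) := fun x y => by
  rw [Equiv.trans_apply, Equiv.trans_apply, h', h]

theorem isAuto_refl : IsAuto (Equiv.refl (Perm (Fin n))) := fun _ _ => Iff.rfl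

theorem IsAuto.walk_iff (h : IsAuto φ) {r : ℕ} {x y : Perm (Fin n)} :
    Walk r (φ x) (φ y) ↔ Walk r x y := by
  have key : ∀ {φ : Perm (Perm (Fin n))} (_ : IsAuto φ) {r : ℕ} {x y : Perm (Fin n)},
      Walk r x y → Walk r (φ x) (φ y) := by
    intro φ h r x y hw
    induction hw with
    | refl => exact .refl _
    | cons e _ ih => exact ih.cons ((h _ _).2 e)
  refine ⟨fun hw => ?_, key h⟩
  simpa using key h.symm hw

theorem IsAuto.le_iff (h : IsAuto φ) {x y : Perm (Fin n)} :
    BruhatLE (φ x) (φ y) ↔ BruhatLE x y := by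
  constructor
  · intro hl
    obtain ⟨r, hr⟩ := hl.exists_walk
    exact (h.walk_iff.1 hr).le
  · intro hl
    obtain ⟨r, hr⟩ := hl.exists_walk
    exact (h.walk_iff.2 hr).le

theorem IsAuto.dist_eq (h : IsAuto φ) (x y : Perm (Fin n)) : dist (φ x) (φ y) = dist x y := by
  simp only [dist_eq_sInf_walk, h.walk_iff]

theorem IsAuto.mem_interval_iff (h : IsAuto φ) {x y w : Perm (Fin n)} :
    φ w ∈ interval (φ x) (φ y) ↔ w ∈ interval x y :=
  and_congr h.le_iff h.le_iff

theorem IsAuto.mem_shortcuts_iff (h : IsAuto φ) {u v z p : Perm (Fin n)} :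
    φ p ∈ shortcuts (φ u) (φ v) (φ z) ↔ p ∈ shortcuts u v z := by
  simp only [SymBruhat.mem_shortcuts_iff]
  rw [φ.surjective.forall]
  simp only [h.mem_interval_iff, h.walk_iff, h.dist_eq, φ.injective.eq_iff]

theorem IsAuto.isMinimum_iff (h : IsAuto φ) {A : Set (Perm (Fin n))} {m : Perm (Fin n)} :
    IsMinimum A (φ m) ↔ IsMinimum (φ ⁻¹' A) m := by
  unfold IsMinimum
  rw [φ.surjective.forall]
  simp only [h.le_iff, Set.mem_preimage]

theorem isAuto_inv : IsAuto (Equiv.inv (Perm (Fin n))) := by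
  have key : ∀ x y : Perm (Fin n), Edge x y → Edge x⁻¹ y⁻¹ := by
    intro x y h
    obtain ⟨i, j, hij, hx, rfl⟩ := edge_iff.1 h
    refine edge_iff.2 ⟨x i, x j, hx, by simpa using hij, ?_⟩
    rw [Equiv.swap_apply_apply, mul_inv_rev, Equiv.swap_inv]
    group
  intro x y
  refine ⟨fun h => ?_, key x y⟩
  simpa using key _ _ h

/-- Conjugation by the longest element. -/
def revConj (n : ℕ) : Perm (Perm (Fin n)) := (Fin.revPerm : Perm (Fin n)).permCongr

theorem revConj_apply (x : Perm (Fin n)) (i : Fin n) : revConj n x i = (x i.rev).rev := by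
  simp [revConj]

theorem revConj_revConj (x : Perm (Fin n)) : revConj n (revConj n x) = x := by
  ext i
  simp [revConj_apply]

theorem revConj_mul (x y : Perm (Fin n)) : revConj n (x * y) = revConj n x * revConj n y := by
  ext i
  simp [revConj_apply]

theorem revConj_inv (x : Perm (Fin n)) : revConj n x⁻¹ = (revConj n x)⁻¹ := by
  rw [eq_inv_iff_mul_eq_one, ← revConj_mul, inv_mul_cancel]
  ext i
  simp [revConj_apply]

theorem revConj_swap (i j : Fin n) : revConj n (Equiv.swap i j) = Equiv.swap i.rev j.rev := by
  ext k
  rw [revConj_apply]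
  have := (Fin.revPerm : Perm (Fin n)).injective.swap_apply i j k.rev
  simp only [Fin.revPerm_apply, Fin.rev_rev] at this
  rw [this]

theorem isAuto_revConj : IsAuto (revConj n) := by
  have key : ∀ x y : Perm (Fin n), Edge x y → Edge (revConj n x) (revConj n y) := by
    intro x y h
    obtain ⟨i, j, hij, hx, rfl⟩ := edge_iff.1 h
    refine edge_iff.2 ⟨j.rev, i.rev, by simpa using hij, by simpa [revConj_apply] using hx, ?_⟩
    rw [revConj_mul, revConj_swap, Equiv.swap_comm]
  intro x y
  refine ⟨fun h => ?_, key x y⟩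
  have := key _ _ h
  rwa [revConj_revConj, revConj_revConj] at this

end Automorphisms

/-! ### Walks that move the last letter -/

section LastLetter

variable {m : ℕ}

open Fin (last)

theorem Edge.last_le {x y : Perm (Fin (m + 1))} (h : Edge x y) : y (last m) ≤ x (last m) := by
  obtain ⟨i, j, hij, hx, rfl⟩ := edge_iff.1 h
  rw [Perm.mul_apply]
  by_cases hj : j = last m
  · subst hj
    rw [Equiv.swap_apply_right]
    exact hx.le
  · rw [Equiv.swap_apply_of_ne_of_ne (hij.trans_le (Fin.le_last j)).ne' (Ne.symm hj)]

theorem BruhatLE.last_le {x y : Perm (Fin (m + 1))} (h : BruhatLE x y) :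
    y (last m) ≤ x (last m) := by
  induction h with
  | refl => exact le_rfl
  | tail _ e ih => exact e.last_le.trans ih

theorem edge_mul_swap_last {x : Perm (Fin (m + 1))} {i : Fin (m + 1)} (hi : i ≠ last m)
    (h : x i < x (last m)) : Edge x (x * Equiv.swap i (last m)) :=
  edge_mul_swap (lt_of_le_of_ne (Fin.le_last i) hi) h

theorem swap_mul_swap_conj {α : Type*} [DecidableEq α] (a b c d : α) :
    Equiv.swap a b * Equiv.swap c d =
      Equiv.swap (Equiv.swap a b c) (Equiv.swap a b d) * Equiv.swap a b :=
  Equiv.mul_swap_eq_swap_mul _ _ _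

/-- A two-step walk whose second step moves the last letter can be replaced by one with a smaller
last letter in between, unless both steps move the last letter, the first from the right of the
second. -/
theorem exists_edge_edge_last_lt {x y : Perm (Fin (m + 1))} {i : Fin (m + 1)} (hxy : Edge x y)
    (hi : i ≠ last m) (hyi : y i < y (last m))
    (hne : ∀ j, i < j → j ≠ last m → x j < x (last m) → y ≠ x * Equiv.swap j (last m)) :
    ∃ y', Edge x y' ∧ Edge y' (y * Equiv.swap i (last m)) ∧ y' (last m) < y (last m) := by
  obtain ⟨a, b, hab, hx, rfl⟩ := edge_iff.1 hxy
  have han : a ≠ last m := (hab.trans_le (Fin.le_last b)).ne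
  have hin := lt_of_le_of_ne (Fin.le_last i) hi
  -- The new middle element is always `x * swap k (last m)` with `k` one of `i`, `a`, `b`. The cases
  -- are the possible coincidences among the positions of the two transpositions.
  by_cases hb : b = last m
  · subst hb
    by_cases hia : i = a
    · subst hia
      simp at hyi
      exact absurd hyi hx.not_gt
    have hai : a < i := by
      by_contra h
      exact hne a (lt_of_le_of_ne (not_lt.1 h) hia) han hx rfl
    rw [Perm.mul_apply, Perm.mul_apply, Equiv.swap_apply_of_ne_of_ne hia hi,
      Equiv.swap_apply_right] at hyi
    refine ⟨x * Equiv.swap i (last m), edge_mul_swap_last hi (hyi.trans hx), ?_, ?_⟩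
    · have h : x * Equiv.swap a (last m) * Equiv.swap i (last m) =
          x * Equiv.swap i (last m) * Equiv.swap a i := by
        rw [mul_assoc, mul_assoc, swap_mul_swap_conj i, Equiv.swap_apply_left,
          Equiv.swap_apply_of_ne_of_ne (Ne.symm hia) han]
      rw [h]
      refine edge_mul_swap hai ?_
      simpa [Equiv.swap_apply_of_ne_of_ne (Ne.symm hia) han] using hx
    · simpa using hyi
  · have hbn := lt_of_le_of_ne (Fin.le_last b) hb
    by_cases hib : i = b
    · subst hib
      have hyi' : x a < x (last m) := by
        simpa [Equiv.swap_apply_of_ne_of_ne (Ne.symm han) (Ne.symm hb)] using hyi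
      rcases lt_or_gt_of_ne (fun h => hi (x.injective h) : x i ≠ x (last m)) with h | h
      · refine ⟨x * Equiv.swap i (last m), edge_mul_swap_last hi h, ?_, ?_⟩
        · have h : x * Equiv.swap a i * Equiv.swap i (last m) =
              x * Equiv.swap i (last m) * Equiv.swap a (last m) := by
            rw [mul_assoc, mul_assoc, swap_mul_swap_conj i, Equiv.swap_apply_right,
              Equiv.swap_apply_of_ne_of_ne hab.ne han]
          rw [h]
          refine edge_mul_swap_last han ?_
          simpa [Equiv.swap_apply_of_ne_of_ne hab.ne han] using hx
        · simpa [Equiv.swap_apply_of_ne_of_ne (Ne.symm han) (Ne.symm hb)] using h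
      · refine ⟨x * Equiv.swap a (last m), edge_mul_swap_last han hyi', ?_, ?_⟩
        · have h' : x * Equiv.swap a i * Equiv.swap i (last m) =
              x * Equiv.swap a (last m) * Equiv.swap a i := by
            rw [mul_assoc, mul_assoc, swap_mul_swap_conj a i, Equiv.swap_apply_right,
              Equiv.swap_apply_of_ne_of_ne (Ne.symm han) (Ne.symm hb)]
          rw [h']
          refine edge_mul_swap hab ?_
          simpa [Equiv.swap_apply_of_ne_of_ne hab.ne' hi] using h
        · simpa [Equiv.swap_apply_of_ne_of_ne (Ne.symm han) (Ne.symm hb)] using hyi'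
    · by_cases hia : i = a
      · subst hia
        have hyi' : x b < x (last m) := by
          simpa [Equiv.swap_apply_of_ne_of_ne (Ne.symm han) (Ne.symm hb)] using hyi
        refine ⟨x * Equiv.swap b (last m), edge_mul_swap_last hb hyi', ?_, ?_⟩
        · have h : x * Equiv.swap i b * Equiv.swap i (last m) =
              x * Equiv.swap b (last m) * Equiv.swap i b := by
            rw [mul_assoc, mul_assoc, swap_mul_swap_conj i b, Equiv.swap_apply_left,
              Equiv.swap_apply_of_ne_of_ne (Ne.symm han) (Ne.symm hb)]
          rw [h]
          refine edge_mul_swap hab ?_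
          simpa [Equiv.swap_apply_of_ne_of_ne hib hi] using hx.trans hyi'
        · simpa [Equiv.swap_apply_of_ne_of_ne (Ne.symm han) (Ne.symm hb)] using hyi'
      · have hyi' : x i < x (last m) := by
          simpa [Equiv.swap_apply_of_ne_of_ne (Ne.symm han) (Ne.symm hb),
            Equiv.swap_apply_of_ne_of_ne hia hib] using hyi
        refine ⟨x * Equiv.swap i (last m), edge_mul_swap_last hi hyi', ?_, ?_⟩
        · have h : x * Equiv.swap a b * Equiv.swap i (last m) =
              x * Equiv.swap i (last m) * Equiv.swap a b := by
            rw [mul_assoc, mul_assoc, swap_mul_swap_conj i,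
              Equiv.swap_apply_of_ne_of_ne (Ne.symm hia) han,
              Equiv.swap_apply_of_ne_of_ne (Ne.symm hib) hb]
          rw [h]
          refine edge_mul_swap hab ?_
          simpa [Equiv.swap_apply_of_ne_of_ne (Ne.symm hia) han,
            Equiv.swap_apply_of_ne_of_ne (Ne.symm hib) hb] using hx
        · simpa [Equiv.swap_apply_of_ne_of_ne (Ne.symm han) (Ne.symm hb)] using hyi'

/-- `Chain c u p`: the list `c` of positions is decreasing, and exchanging the last letter
successively with the letters in these positions leads from `u` upwards to `p`. -/
inductive Chain : List (Fin (m + 1)) → Perm (Fin (m + 1)) → Perm (Fin (m + 1)) → Prop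
  | nil (u : Perm (Fin (m + 1))) : Chain [] u u
  | cons {i : Fin (m + 1)} {c : List (Fin (m + 1))} {u p : Perm (Fin (m + 1))} :
      i ≠ last m → (∀ j ∈ c, j < i) → u i < u (last m) →
      Chain c (u * Equiv.swap i (last m)) p → Chain (i :: c) u p

theorem Chain.walk {c : List (Fin (m + 1))} {u p : Perm (Fin (m + 1))} (h : Chain c u p) :
    Walk c.length u p := by
  induction h with
  | nil => exact .refl _
  | cons hi _ hu _ ih => exact ih.cons (edge_mul_swap_last hi hu)

/-- Every walk can be replaced by one of the same length that starts with a chain and does not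
move the last letter afterwards. -/
theorem Walk.exists_chain {r : ℕ} {u p : Perm (Fin (m + 1))} (h : Walk r u p) :
    ∃ c q s, Chain c u q ∧ Walk s q p ∧ c.length + s = r ∧ q (last m) = p (last m) := by
  induction r generalizing u p with
  | zero =>
    cases h
    exact ⟨[], _, 0, .nil _, .refl _, rfl, rfl⟩
  | succ r ih =>
    -- Inner induction on the last letter after the first step. If the rest, rearranged into a
    -- chain, cannot be prolonged by the first step, then the first two steps are replaced by a pair
    -- whose middle element has a smaller last letter.
    suffices ∀ k : Fin (m + 1), ∀ x, x (last m) = k → Edge u x → Walk r x p →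
        ∃ c q s, Chain c u q ∧ Walk s q p ∧ c.length + s = r + 1 ∧ q (last m) = p (last m) by
      cases h with
      | cons e h' => exact this _ _ rfl e h'
    intro k
    induction k using WellFoundedLT.induction with
    | ind k ihk =>
    rintro x rfl hux hxp
    obtain ⟨c, q, s, hc, hs, hl, hq⟩ := ih hxp
    cases hc with
    | nil =>
      by_cases hx : ∃ j, j ≠ last m ∧ u j < u (last m) ∧ x = u * Equiv.swap j (last m)
      · obtain ⟨j, hj, huj, rfl⟩ := hx
        exact ⟨[j], _, s, .cons hj (by simp) huj (.nil _), hs, by simp at hl ⊢; omega, hq⟩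
      · obtain ⟨a, b, hab, hu, rfl⟩ := edge_iff.1 hux
        have hb : b ≠ last m := by
          rintro rfl
          exact hx ⟨a, hab.ne, hu, rfl⟩
        refine ⟨[], u, r + 1, .nil _, hxp.cons hux, by simp, ?_⟩
        rw [← hq, Perm.mul_apply, Equiv.swap_apply_of_ne_of_ne
          (hab.trans_le (Fin.le_last b)).ne' hb.symm]
    | @cons i c _ _ hi hci hxi hc =>
      by_cases hx : ∃ j, i < j ∧ j ≠ last m ∧ u j < u (last m) ∧ x = u * Equiv.swap j (last m)
      · obtain ⟨j, hij, hj, huj, rfl⟩ := hx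
        refine ⟨j :: i :: c, q, s, .cons hj ?_ huj (.cons hi hci hxi hc), hs, ?_, hq⟩
        · rintro a (_ | ⟨_, ha⟩)
          · exact hij
          · exact (hci a ha).trans hij
        · simp at hl ⊢; omega
      · push Not at hx
        obtain ⟨y, h1, h2, h3⟩ := exists_edge_edge_last_lt hux hi hxi hx
        refine ihk _ h3 y rfl h1 ?_
        have := (h2.walk.trans hc.walk).trans hs
        simp only [List.length_cons] at hl
        rwa [show 1 + c.length + s = r by omega] at this

theorem BruhatLE.exists_mul_swap_last {u x : Perm (Fin (m + 1))} (h : BruhatLE u x)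
    (hlt : x (last m) < u (last m)) : ∃ i, i ≠ last m ∧ u i < u (last m) ∧
      BruhatLE (u * Equiv.swap i (last m)) x := by
  obtain ⟨r, hr⟩ := h.exists_walk
  obtain ⟨c, q, s, hc, hs, -, hq⟩ := hr.exists_chain
  cases hc with
  | nil => exact absurd hq hlt.ne'
  | @cons i c _ _ hi _ hu hc => exact ⟨i, hi, hu, hc.walk.le.trans hs.le⟩

/-- This is the greedy step towards the minimum with a given last letter: `g` is the rightmost
position whose letter lies between the target and the current last letter. Some exchange at `i`
stays below `x`, and `i ≤ g` by maximality. If `u i < u g`, the exchange at `g` lies below the one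
at `i`. Otherwise the induction applies after the exchange at `i`, and its result lies above the
exchange at `g`. -/
theorem BruhatLE.mul_swap_last_le {g : Fin (m + 1)} (hg : g ≠ last m) {x : Perm (Fin (m + 1))} :
    ∀ (k : Fin (m + 1)) (u : Perm (Fin (m + 1))), u (last m) = k → BruhatLE u x →
    x (last m) ≤ u g → u g < u (last m) →
    (∀ i, i ≠ last m → x (last m) ≤ u i → u i < u (last m) → i ≤ g) →
    BruhatLE (u * Equiv.swap g (last m)) x := by
  intro k
  induction k using WellFoundedLT.induction with
  | ind k ih =>
  rintro u rfl hux hxg hgu hmax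
  obtain ⟨i, hi, hui, hix⟩ := hux.exists_mul_swap_last (hxg.trans_lt hgu)
  by_cases hig : i = g
  · exact hig ▸ hix
  have hxi : x (last m) ≤ u i := by simpa using hix.last_le
  have hig' : i < g := lt_of_le_of_ne (hmax i hi hxi hui) hig
  rcases lt_or_gt_of_ne (fun h => hig (u.injective h) : u i ≠ u g) with h | h
  · have h1 : u * Equiv.swap g (last m) * Equiv.swap i (last m) * Equiv.swap i g =
        u * Equiv.swap i (last m) := by
      rw [mul_assoc, mul_assoc, swap_mul_swap_conj i, Equiv.swap_apply_left,
        Equiv.swap_apply_of_ne_of_ne (Ne.symm hig) hg, Equiv.swap_comm (last m),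
        Equiv.swap_mul_self_mul]
    have h2 : Edge (u * Equiv.swap g (last m)) (u * Equiv.swap g (last m) *
        Equiv.swap i (last m)) := by
      refine edge_mul_swap_last hi ?_
      simpa [Equiv.swap_apply_of_ne_of_ne hig hi] using h
    have h3 : Edge (u * Equiv.swap g (last m) * Equiv.swap i (last m))
        (u * Equiv.swap i (last m)) := by
      rw [← h1]
      refine edge_mul_swap hig' ?_
      simpa [Equiv.swap_apply_of_ne_of_ne (Ne.symm hig) hg] using hgu
    exact h2.le.trans (h3.le.trans hix)
  · have h1 : u * Equiv.swap i (last m) * Equiv.swap g (last m) =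
        u * Equiv.swap g (last m) * Equiv.swap i g := by
      rw [mul_assoc, mul_assoc, swap_mul_swap_conj g, Equiv.swap_apply_left,
        Equiv.swap_apply_of_ne_of_ne hig hi]
    have h2 : Edge (u * Equiv.swap g (last m)) (u * Equiv.swap i (last m) *
        Equiv.swap g (last m)) := by
      rw [h1]
      refine edge_mul_swap hig' ?_
      simpa [Equiv.swap_apply_of_ne_of_ne hig hi] using hui
    refine h2.le.trans (ih (u i) hui _ (by simp) hix ?_ ?_ ?_)
    · simpa [Equiv.swap_apply_of_ne_of_ne (Ne.symm hig) hg] using hxg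
    · simpa [Equiv.swap_apply_of_ne_of_ne (Ne.symm hig) hg] using h
    · intro j hj hxj hju
      by_cases hji : j = i
      · exact hji ▸ hig'.le
      · simp [Equiv.swap_apply_of_ne_of_ne hji hj] at hxj hju
        exact hmax j hj hxj (hju.trans hui)

/-- The permutations above `u` with a given last letter `r ≤ u(n)` have a minimum. -/
theorem exists_isMinimum_last (r : Fin (m + 1)) :
    ∀ (k : Fin (m + 1)) (u : Perm (Fin (m + 1))), u (last m) = k → r ≤ u (last m) →
    ∃ z, IsMinimum {x | BruhatLE u x ∧ x (last m) = r} z := by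
  intro k
  induction k using WellFoundedLT.induction with
  | ind k ih =>
  rintro u rfl hr
  rcases hr.eq_or_lt with h | h
  · exact ⟨u, ⟨.refl u, h.symm⟩, fun x hx => hx.1⟩
  -- The rightmost element of this set is the forced first exchange; the position of the letter `r`
  -- shows that the set is nonempty.
  set S := Finset.univ.filter fun i => i ≠ last m ∧ r ≤ u i ∧ u i < u (last m) with hS
  have hne : S.Nonempty := by
    refine ⟨u.symm r, ?_⟩
    simp only [hS, Finset.mem_filter, Finset.mem_univ, true_and, Equiv.apply_symm_apply]
    refine ⟨?_, le_rfl, h⟩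
    rintro h1
    rw [← h1, Equiv.apply_symm_apply] at h
    exact lt_irrefl _ h
  obtain ⟨g, hgS, hgmax⟩ := S.exists_max_image id hne
  simp only [hS, Finset.mem_filter, Finset.mem_univ, true_and, id] at hgS hgmax
  obtain ⟨z, ⟨hz1, hz2⟩, hz3⟩ := ih (u g) hgS.2.2 (u * Equiv.swap g (last m)) (by simp)
    (by simpa using hgS.2.1)
  refine ⟨z, ⟨(edge_mul_swap_last hgS.1 hgS.2.2).le.trans hz1, hz2⟩, ?_⟩
  rintro x ⟨hx, rfl⟩
  exact hz3 x ⟨BruhatLE.mul_swap_last_le hgS.1 _ u rfl hx hgS.2.1 hgS.2.2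
    fun i h1 h2 h3 => hgmax i ⟨h1, h2, h3⟩, rfl⟩

end LastLetter

/-! ### Shortcuts -/

/-- The vectors `e_c - e_j` form a star and are independent. If they already exhaust the dimension
of `V`, then `V` and `e_c` together span only the coordinates in `insert c S`, so no difference in
`V` can involve another coordinate. -/
theorem card_le_finrank_of_sub_mem {ι : Type*} [Fintype ι] [DecidableEq ι]
    {V : Submodule ℚ (ι → ℚ)} {S : Finset ι} {c : ι} (hc : c ∉ S)
    (hS : ∀ j ∈ S, (Pi.single c 1 - Pi.single j 1 : ι → ℚ) ∈ V) :
    S.card ≤ Module.finrank ℚ V ∧ (Module.finrank ℚ V ≤ S.card → ∀ a b, a ≠ b →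
      (Pi.single a 1 - Pi.single b 1 : ι → ℚ) ∈ V → a ∈ insert c S) := by
  classical
  set e : ι → ι → ℚ := fun j => Pi.single j 1 with he
  set U : Submodule ℚ (ι → ℚ) := Submodule.span ℚ ((insert c S).image e : Finset (ι → ℚ)) with hU
  set W : Submodule ℚ (ι → ℚ) := V ⊔ Submodule.span ℚ {e c} with hW
  have hec : e c ∈ W := Submodule.mem_sup_right (Submodule.mem_span_singleton_self _)
  have hUW : U ≤ W := by
    rw [hU, Submodule.span_le]
    intro x hx
    simp only [Finset.coe_image, Set.mem_image, Finset.mem_coe, Finset.mem_insert] at hx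
    obtain ⟨j, rfl | hj, rfl⟩ := hx
    · exact hec
    · have := W.sub_mem hec (Submodule.mem_sup_left (hS j hj))
      simpa [he] using this
  have hli : LinearIndependent ℚ e := Pi.linearIndependent_single_one ι ℚ
  have hUc : Module.finrank ℚ U = S.card + 1 := by
    rw [hU, finrank_span_finset_eq_card, Finset.card_image_of_injective _ hli.injective,
      Finset.card_insert_of_notMem hc]
    rw [Finset.coe_image]
    exact (hli.linearIndepOn (insert c S : Finset ι)).id_image
  have hWc : Module.finrank ℚ W ≤ Module.finrank ℚ V + 1 := by
    refine (Submodule.finrank_add_le_finrank_add_finrank _ _).trans ?_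
    gcongr
    exact (finrank_span_le_card _).trans (by simp)
  have hle := Submodule.finrank_mono hUW
  refine ⟨by omega, fun h a b hab hm => ?_⟩
  have hUeq : U = W := Submodule.eq_of_le_of_finrank_le hUW (by omega)
  by_contra ha
  have hker : U ≤ LinearMap.ker (LinearMap.proj a : (ι → ℚ) →ₗ[ℚ] ℚ) := by
    rw [hU, Submodule.span_le]
    intro x hx
    simp only [Finset.coe_image, Set.mem_image, Finset.mem_coe] at hx
    obtain ⟨j, hj, rfl⟩ := hx
    have : a ≠ j := fun h => ha (h ▸ hj)
    simp [he, this]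
  have h1 := hker (hUeq ▸ Submodule.mem_sup_left hm : (Pi.single a 1 - Pi.single b 1 : ι → ℚ) ∈ U)
  simp [hab] at h1

/-- `V` is spanned by the vectors `e_i - e_j` of the transpositions used. Each letter moves only
along these transpositions, so its total displacement lies in `V`. -/
theorem Walk.exists_submodule {n r : ℕ} {u p : Perm (Fin n)} (h : Walk r u p) :
    ∃ V : Submodule ℚ (Fin n → ℚ), Module.finrank ℚ V ≤ r ∧
      ∀ x, (Pi.single (u⁻¹ x) 1 - Pi.single (p⁻¹ x) 1 : Fin n → ℚ) ∈ V := by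
  induction h with
  | refl => exact ⟨⊥, by simp, by simp⟩
  | cons e _ ih =>
    obtain ⟨V, hV, h⟩ := ih
    obtain ⟨i, j, -, -, rfl⟩ := edge_iff.1 e
    rename_i r x z _
    refine ⟨V ⊔ Submodule.span ℚ {Pi.single i 1 - Pi.single j 1}, ?_, fun k => ?_⟩
    · refine (Submodule.finrank_add_le_finrank_add_finrank _ _).trans ?_
      gcongr
      exact (finrank_span_le_card _).trans (by simp)
    · have h1 := Submodule.mem_sup_left (T := Submodule.span ℚ
        {(Pi.single i 1 - Pi.single j 1 : Fin n → ℚ)}) (h k)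
      have h2 := Submodule.mem_sup_right (S := V) (Submodule.mem_span_singleton_self (R := ℚ)
        (Pi.single i 1 - Pi.single j 1 : Fin n → ℚ))
      rw [mul_inv_rev, Equiv.swap_inv, Perm.mul_apply] at h1
      by_cases hi : x⁻¹ k = i
      · rw [hi, Equiv.swap_apply_left] at h1
        rw [hi]
        simpa using add_mem h2 h1
      · by_cases hj : x⁻¹ k = j
        · rw [hj, Equiv.swap_apply_right] at h1
          rw [hj]
          simpa using sub_mem h1 h2
        · rwa [Equiv.swap_apply_of_ne_of_ne hi hj] at h1

section Chains

variable {m : ℕ}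

open Fin (last)

theorem Chain.ne_last {c : List (Fin (m + 1))} {u p : Perm (Fin (m + 1))} (h : Chain c u p) :
    ∀ j ∈ c, j ≠ last m := by
  induction h with
  | nil => simp
  | cons hi _ _ _ ih => simpa [hi] using ih

theorem Chain.nodup {c : List (Fin (m + 1))} {u p : Perm (Fin (m + 1))} (h : Chain c u p) :
    c.Nodup := by
  induction h with
  | nil => simp
  | cons _ hc _ _ ih => exact List.nodup_cons.2 ⟨fun h => lt_irrefl _ (hc _ h), ih⟩

theorem Chain.apply_of_notMem {c : List (Fin (m + 1))} {u p : Perm (Fin (m + 1))}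
    (h : Chain c u p) {j : Fin (m + 1)} (hj : j ∉ c) (hj' : j ≠ last m) : p j = u j := by
  induction h with
  | nil => rfl
  | cons _ _ _ _ ih =>
    rw [List.mem_cons, not_or] at hj
    rw [ih hj.2, Perm.mul_apply, Equiv.swap_apply_of_ne_of_ne hj.1 hj']

theorem Chain.apply_head {i : Fin (m + 1)} {c : List (Fin (m + 1))} {u p : Perm (Fin (m + 1))}
    (h : Chain (i :: c) u p) : p i = u (last m) := by
  have h' := h.nodup
  cases h with
  | cons hi _ _ h =>
    rw [h.apply_of_notMem (List.nodup_cons.1 h').1 hi, Perm.mul_apply, Equiv.swap_apply_left]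

theorem Chain.apply_le {c : List (Fin (m + 1))} {u p : Perm (Fin (m + 1))} (h : Chain c u p) :
    ∀ j ∈ c, p j ≤ u (last m) := by
  induction h with
  | nil => simp
  | cons hi hc hu h ih =>
    rintro j (_ | ⟨_, hj⟩)
    · exact (Chain.apply_head (.cons hi hc hu h)).le
    · have := ih j hj
      rw [Perm.mul_apply, Equiv.swap_apply_right] at this
      exact this.trans hu.le

/-- The letters dropped along a chain decrease while the positions move to the left. -/
theorem Chain.apply_lt_apply {c : List (Fin (m + 1))} {u p : Perm (Fin (m + 1))}
    (h : Chain c u p) : ∀ i ∈ c, ∀ j ∈ c, i < j → p i < p j := by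
  induction h with
  | nil => simp
  | @cons k c u p hk hc hu h ih =>
    intro i hi j hj hij
    rcases List.mem_cons.1 hj with rfl | hj'
    · rw [Chain.apply_head (.cons hk hc hu h)]
      rcases List.mem_cons.1 hi with rfl | hi
      · exact absurd hij (lt_irrefl _)
      · have := h.apply_le i hi
        rw [Perm.mul_apply, Equiv.swap_apply_right] at this
        exact this.trans_lt hu
    · rcases List.mem_cons.1 hi with rfl | hi
      · exact absurd (hc j hj') hij.not_gt
      · exact ih i hi j hj' hij

/-- The displacements of the letters link the last position to the positions of the chain in one
cycle, so they generate the star centred at the last position. -/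
theorem Chain.sub_mem {c : List (Fin (m + 1))} {u p : Perm (Fin (m + 1))} (h : Chain c u p)
    {V : Submodule ℚ (Fin (m + 1) → ℚ)}
    (hV : ∀ x, (Pi.single (u⁻¹ x) 1 - Pi.single (p⁻¹ x) 1 : Fin (m + 1) → ℚ) ∈ V) :
    ∀ j ∈ c, (Pi.single (last m) 1 - Pi.single j 1 : Fin (m + 1) → ℚ) ∈ V := by
  induction h with
  | nil => simp
  | @cons i c u p hi hc hu h ih =>
    have h1 : (Pi.single (last m) 1 - Pi.single i 1 : Fin (m + 1) → ℚ) ∈ V := by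
      have := hV (u (last m))
      rwa [Perm.inv_eq_iff_eq.2 (Chain.apply_head (.cons hi hc hu h)).symm,
        Perm.inv_eq_iff_eq.2 rfl] at this
    rintro j (_ | ⟨_, hj⟩)
    · exact h1
    refine ih (fun x => ?_) j hj
    have h2 := hV x
    rw [mul_inv_rev, Equiv.swap_inv, Perm.mul_apply]
    by_cases hxi : u⁻¹ x = i
    · rw [hxi] at h2
      rw [hxi, Equiv.swap_apply_left]
      simpa using add_mem h1 h2
    · by_cases hxl : u⁻¹ x = last m
      · rw [hxl] at h2
        rw [hxl, Equiv.swap_apply_right]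
        simpa using Submodule.sub_mem _ h2 h1
      · rwa [Equiv.swap_apply_of_ne_of_ne hxi hxl]

theorem Chain.length_le {c : List (Fin (m + 1))} {u p : Perm (Fin (m + 1))} (h : Chain c u p)
    {r : ℕ} (hr : Walk r u p) : c.length ≤ r := by
  obtain ⟨V, hV, hV'⟩ := hr.exists_submodule
  have h1 := (card_le_finrank_of_sub_mem (S := c.toFinset) (c := last m)
    (fun hl => h.ne_last _ (List.mem_toFinset.1 hl) rfl)
    (fun j hj => h.sub_mem hV' j (List.mem_toFinset.1 hj))).1
  rw [List.toFinset_card_of_nodup h.nodup] at h1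
  exact h1.trans hV

theorem Chain.dist_eq {c : List (Fin (m + 1))} {u p : Perm (Fin (m + 1))} (h : Chain c u p) :
    dist u p = c.length :=
  h.walk.dist_le.antisymm (h.length_le h.walk.le.walk_dist)

/-- The last step of a shortest walk between the ends of a chain moves the last letter. -/
theorem Chain.eq_of_walk {c : List (Fin (m + 1))} {u y p : Perm (Fin (m + 1))} (h : Chain c u p)
    {r s : ℕ} (hr : Walk r u y) (hs : Walk s y p) (hrs : r + s = c.length)
    (hy : y (last m) = p (last m)) : y = p := by
  rcases hs.eq_or_exists_last with ⟨-, h0⟩ | ⟨s, w, rfl, hs, e⟩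
  · exact h0
  exfalso
  have hw : w (last m) = p (last m) :=
    le_antisymm (hy ▸ hs.le.last_le) e.last_le
  obtain ⟨V, hV, hV'⟩ := (hr.trans hs).exists_submodule
  obtain ⟨a, b, hab, hwab, rfl⟩ := edge_iff.1 e
  set p := w * Equiv.swap a b with hp
  set W := V ⊔ Submodule.span ℚ {(Pi.single a 1 - Pi.single b 1 : Fin (m + 1) → ℚ)} with hW
  have hWr : Module.finrank ℚ W ≤ c.length := by
    refine (Submodule.finrank_add_le_finrank_add_finrank _ _).trans ?_
    have : Module.finrank ℚ (Submodule.span ℚ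
        {(Pi.single a 1 - Pi.single b 1 : Fin (m + 1) → ℚ)}) ≤ 1 :=
      (finrank_span_le_card _).trans (by simp)
    omega
  have hmem : (Pi.single a 1 - Pi.single b 1 : Fin (m + 1) → ℚ) ∈ W :=
    Submodule.mem_sup_right (Submodule.mem_span_singleton_self _)
  have hWp : ∀ x, (Pi.single (u⁻¹ x) 1 - Pi.single (p⁻¹ x) 1 : Fin (m + 1) → ℚ) ∈ W := by
    intro x
    have h1 := Submodule.mem_sup_left (T := Submodule.span ℚ
        {(Pi.single a 1 - Pi.single b 1 : Fin (m + 1) → ℚ)}) (hV' x)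
    rw [hp, mul_inv_rev, Equiv.swap_inv, Perm.mul_apply]
    by_cases hi : w⁻¹ x = a
    · rw [hi] at h1
      rw [hi, Equiv.swap_apply_left]
      simpa using add_mem h1 hmem
    · by_cases hj : w⁻¹ x = b
      · rw [hj] at h1
        rw [hj, Equiv.swap_apply_right]
        simpa using Submodule.sub_mem _ h1 hmem
      · rwa [Equiv.swap_apply_of_ne_of_ne hi hj]
  -- The walk has exactly `c.length` steps, so the star exhausts `W`. Hence the final transposition
  -- only involves the last position and positions in `c`.
  have hin := (card_le_finrank_of_sub_mem (S := c.toFinset) (c := last m) (V := W)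
    (fun hl => h.ne_last _ (List.mem_toFinset.1 hl) rfl)
    (fun j hj => h.sub_mem hWp j (List.mem_toFinset.1 hj))).2
    (by rwa [List.toFinset_card_of_nodup h.nodup])
  have hb : b ≠ last m := by
    rintro rfl
    rw [hp, Perm.mul_apply, Equiv.swap_apply_right] at hw
    exact hab.ne (w.injective hw).symm
  have hac : a ∈ c := by
    have := hin a b hab.ne hmem
    rw [Finset.mem_insert, List.mem_toFinset] at this
    exact this.resolve_left (hab.trans_le (Fin.le_last b)).ne
  have hbc : b ∈ c := by
    have := hin b a hab.ne' (by simpa using W.neg_mem hmem)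
    rw [Finset.mem_insert, List.mem_toFinset] at this
    exact this.resolve_left hb
  -- The end of a chain is increasing on the positions of the chain, whereas the upward step `w → p`
  -- leaves a descent at `a < b`.
  have := h.apply_lt_apply a hac b hbc hab
  rw [hp, Perm.mul_apply, Perm.mul_apply, Equiv.swap_apply_left, Equiv.swap_apply_right] at this
  exact absurd this hwab.not_gt

/-! ### Minima with the last letter of `v`, their joins and their shortcuts -/

/-- `z` is the minimum of the part of `[u, v]` with the same last letter as `v`. -/
def IsLastMin (u v z : Perm (Fin (m + 1))) : Prop :=
  IsMinimum (interval u v ∩ {x | x (last m) = v (last m)}) z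

theorem IsLastMin.mem_interval_iff {u v z x : Perm (Fin (m + 1))} (hz : IsLastMin u v z) :
    x ∈ interval z v ↔ x ∈ interval u v ∧ x (last m) = v (last m) := by
  constructor
  · rintro ⟨h1, h2⟩
    refine ⟨⟨hz.1.1.1.trans h1, h2⟩, le_antisymm ?_ h2.last_le⟩
    exact h1.last_le.trans_eq hz.1.2
  · rintro ⟨h1, h2⟩
    exact ⟨hz.2 x ⟨h1, h2⟩, h1.2⟩

theorem exists_isLastMin {u v : Perm (Fin (m + 1))} (h : BruhatLE u v) :
    ∃ z, IsLastMin u v z := by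
  obtain ⟨z, ⟨h1, h2⟩, h3⟩ := exists_isMinimum_last (v (last m)) _ u rfl h.last_le
  exact ⟨z, ⟨⟨h1, h3 v ⟨h, rfl⟩⟩, h2⟩, fun x hx => h3 x ⟨hx.1.1, hx.2⟩⟩

/-- The upper interval `[z, v]` consists of the elements of `[u, v]` with the last letter of `v`;
intersecting with `[x, v]` gives the same set for `x` in place of `u`. -/
theorem IsLastMin.isJoin_iff {u v z x w : Perm (Fin (m + 1))} (hz : IsLastMin u v z)
    (hx : x ∈ interval u v) : IsJoin v z x w ↔ IsLastMin x v w := by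
  have : interval z v ∩ interval x v = interval x v ∩ {x | x (last m) = v (last m)} := by
    ext y
    rw [Set.mem_inter_iff, hz.mem_interval_iff]
    constructor
    · rintro ⟨⟨_, h2⟩, h3⟩
      exact ⟨h3, h2⟩
    · rintro ⟨h1, h2⟩
      exact ⟨⟨⟨hx.1.trans h1.1, h1.2⟩, h2⟩, h1⟩
  rw [IsJoin, this, IsLastMin]

/-- If `p` is a shortcut, a shortest walk to `p` rearranged to start with a chain enters `[z, v]` at
the end of the chain, which must then be `p`. The converse is `Chain.eq_of_walk`. -/
theorem IsLastMin.mem_shortcuts_iff {u v z p : Perm (Fin (m + 1))} (hz : IsLastMin u v z) :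
    p ∈ shortcuts u v z ↔
      BruhatLE p v ∧ p (last m) = v (last m) ∧ ∃ c, Chain c u p := by
  rw [SymBruhat.mem_shortcuts_iff, hz.mem_interval_iff]
  constructor
  · rintro ⟨⟨hp, hl⟩, h⟩
    obtain ⟨c, q, s, hc, hs, hcs, hq⟩ := hp.1.walk_dist.exists_chain
    have := h q (hz.mem_interval_iff.2 ⟨⟨hc.walk.le, hs.le.trans hp.2⟩, hq.trans hl⟩) _ _
      hc.walk hs hcs
    exact ⟨hp.2, hl, c, this ▸ hc⟩
  · rintro ⟨hp, hl, c, hc⟩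
    refine ⟨⟨⟨hc.walk.le, hp⟩, hl⟩, fun y hy r s hr hs hrs => ?_⟩
    exact hc.eq_of_walk hr hs (hrs.trans hc.dist_eq)
      ((hz.mem_interval_iff.1 hy).2.trans hl.symm)

end Chains

/-! ### Operators on functions on the symmetric group -/

section Operators

variable {n m : ℕ} {M : Type*} [AddCommMonoid M] (q : AddMonoid.End M)

open Fin (last)

/-- Sum `f` over `x` and, with weight `q`, over `x * swap i j` if `x i < x j`. -/
def swapOp (i j : Fin n) : Function.End (Perm (Fin n) → M) :=
  fun f x => f x + if x i < x j then q (f (x * Equiv.swap i j)) else 0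

theorem swapOp_apply (i j : Fin n) (f : Perm (Fin n) → M) (x : Perm (Fin n)) :
    swapOp q i j f x = f x + if x i < x j then q (f (x * Equiv.swap i j)) else 0 := rfl

theorem End.mul_apply {α : Type*} (f g : Function.End α) (x : α) : (f * g) x = f (g x) := rfl

/-- The positions other than the last one, in decreasing order. -/
def descPos (m : ℕ) : List (Fin (m + 1)) := ((List.finRange m).map Fin.castSucc).reverse

/-- Sum `f` over the ends of all chains, weighted by their lengths. -/
def chainOp : Function.End (Perm (Fin (m + 1)) → M) :=
  ((descPos m).map fun i => swapOp q i (last m)).prod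

theorem mem_descPos {i : Fin (m + 1)} : i ∈ descPos m ↔ i ≠ last m := by
  simp only [descPos, List.mem_reverse, List.mem_map, List.mem_finRange, true_and]
  exact Fin.exists_castSucc_eq

theorem pairwise_descPos : (descPos m).Pairwise (· > ·) := by
  rw [descPos, List.pairwise_reverse, List.pairwise_map]
  exact (List.sortedLT_finRange m).pairwise.imp fun h => by simpa using h

-- Expanding the product chooses a subset of the positions in decreasing order. Different chains
-- from `u` have different ends, and `dist u p` is the length of the chain, so the terms can be
-- indexed by `p`.
open scoped Classical in
theorem prod_swapOp_apply (l : List (Fin (m + 1))) (hl : ∀ i ∈ l, i ≠ last m)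
    (hl' : l.Pairwise (· > ·)) (f : Perm (Fin (m + 1)) → M) (u : Perm (Fin (m + 1))) :
    (l.map fun i => swapOp q i (last m)).prod f u =
      ∑ p, if ∃ c, Chain c u p ∧ ∀ j ∈ c, j ∈ l then (q ^ dist u p) (f p) else 0 := by
  induction l generalizing u with
  | nil =>
    rw [Finset.sum_eq_single u]
    · rw [if_pos ⟨[], .nil u, by simp⟩, (Chain.nil u).dist_eq]
      rfl
    · rintro p - hp
      rw [if_neg]
      rintro ⟨c, hc, hc'⟩
      cases hc with
      | nil => exact hp rfl
      | cons => exact absurd (hc' _ List.mem_cons_self) List.not_mem_nil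
    · simp
  | cons i l ih =>
    have hi := hl i List.mem_cons_self
    obtain ⟨hil, hl'⟩ := List.pairwise_cons.1 hl'
    have ih' := fun u => ih (fun j hj => hl j (List.mem_cons_of_mem _ hj)) hl' u
    rw [List.map_cons, List.prod_cons, End.mul_apply, swapOp_apply, ih', ih', map_sum]
    have hsum : ∀ (P : Prop) [Decidable P] (F : Perm (Fin (m + 1)) → M),
        (if P then ∑ p, F p else 0) = ∑ p, if P then F p else 0 := by
      intro P _ F
      split_ifs <;> simp
    rw [hsum, ← Finset.sum_add_distrib]
    refine Finset.sum_congr rfl fun p _ => ?_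
    set u' := u * Equiv.swap i (last m) with hu'
    have hu : u i ≠ u (last m) := fun h => hi (u.injective h)
    -- The letter of `p` at position `i` shows whether the chain uses `i`: it is `u i` if not and `u
    -- (last m)` if so. Hence the two summands never both contribute to the same `p`.
    have h1 : (∃ c, Chain c u p ∧ ∀ j ∈ c, j ∈ l) → p i = u i := by
      rintro ⟨c, hc, hcl⟩
      exact hc.apply_of_notMem (fun h => lt_irrefl _ (hil i (hcl i h))) hi
    have h2 : (∃ c, Chain c u' p ∧ ∀ j ∈ c, j ∈ l) → p i = u (last m) := by
      rintro ⟨c, hc, hcl⟩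
      rw [hc.apply_of_notMem (fun h => lt_irrefl _ (hil i (hcl i h))) hi, hu', Perm.mul_apply,
        Equiv.swap_apply_left]
    by_cases hlt : u i < u (last m)
    · rw [if_pos hlt]
      by_cases h3 : ∃ c, Chain c u p ∧ ∀ j ∈ c, j ∈ l
      · rw [if_pos h3, if_neg fun h => hu ((h1 h3).symm.trans (h2 h)), map_zero, add_zero,
          if_pos]
        obtain ⟨c, hc, hcl⟩ := h3
        exact ⟨c, hc, fun j hj => List.mem_cons_of_mem _ (hcl j hj)⟩
      · rw [if_neg h3, zero_add]
        by_cases h4 : ∃ c, Chain c u' p ∧ ∀ j ∈ c, j ∈ l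
        · rw [if_pos h4]
          obtain ⟨c, hc, hcl⟩ := h4
          have hc' : Chain (i :: c) u p := .cons hi (fun j hj => hil j (hcl j hj)) hlt hc
          rw [if_pos, hc'.dist_eq, hc.dist_eq, List.length_cons, pow_succ']
          · rfl
          · refine ⟨_, hc', ?_⟩
            rintro j (_ | ⟨_, hj⟩)
            · exact List.mem_cons_self
            · exact List.mem_cons_of_mem _ (hcl j hj)
        · rw [if_neg h4, map_zero, if_neg]
          rintro ⟨c, hc, hcl⟩
          cases hc with
          | nil => exact h3 ⟨[], .nil u, by simp⟩
          | @cons k c _ _ hk hck hku hc =>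
            have hcl' : ∀ j ∈ c, j ∈ l := fun j hj => by
              rcases List.mem_cons.1 (hcl j (List.mem_cons_of_mem _ hj)) with rfl | h
              · have h5 := hck _ hj
                rcases List.mem_cons.1 (hcl k List.mem_cons_self) with rfl | h
                · exact absurd h5 (lt_irrefl _)
                · exact absurd (hil k h) h5.not_gt
              · exact h
            rcases List.mem_cons.1 (hcl k List.mem_cons_self) with rfl | h
            · exact h4 ⟨c, hc, hcl'⟩
            · refine h3 ⟨_, .cons hk hck hku hc, ?_⟩
              rintro j (_ | ⟨_, hj⟩)
              · exact h
              · exact hcl' j hj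
    · rw [if_neg hlt, add_zero]
      refine (if_congr ?_ rfl rfl).symm
      constructor
      · rintro ⟨c, hc, hcl⟩
        refine ⟨c, hc, fun j hj => ?_⟩
        cases hc with
        | nil => exact absurd hj List.not_mem_nil
        | @cons k c _ _ hk hck hku hc =>
          have hkl : k ∈ l := by
            rcases List.mem_cons.1 (hcl k List.mem_cons_self) with rfl | h
            · exact absurd hku hlt
            · exact h
          rcases List.mem_cons.1 hj with rfl | hj'
          · exact hkl
          · rcases List.mem_cons.1 (hcl j hj) with rfl | h
            · exact absurd (hil k hkl) (hck _ hj').not_gt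
            · exact h
      · rintro ⟨c, hc, hcl⟩
        exact ⟨c, hc, fun j hj => List.mem_cons_of_mem _ (hcl j hj)⟩

/-- The operator `chainOp` transported along a permutation of the vertices. -/
def autoChainOp (φ : Perm (Perm (Fin (m + 1)))) : Function.End (Perm (Fin (m + 1)) → M) :=
  fun f u => chainOp q (f ∘ φ.symm) (φ u)

open scoped Classical in
theorem autoChainOp_apply {φ : Perm (Perm (Fin (m + 1)))} (hφ : IsAuto φ)
    (f : Perm (Fin (m + 1)) → M) (u : Perm (Fin (m + 1))) :
    autoChainOp q φ f u =
      ∑ p, if ∃ c, Chain c (φ u) (φ p) then (q ^ dist u p) (f p) else 0 := by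
  rw [autoChainOp, chainOp, prod_swapOp_apply q _ (fun i hi => mem_descPos.1 hi) pairwise_descPos,
    ← Equiv.sum_comp φ]
  refine Finset.sum_congr rfl fun p _ => ?_
  rw [hφ.dist_eq, Function.comp_apply, φ.symm_apply_apply]
  refine if_congr (exists_congr fun c => ?_) rfl rfl
  exact and_iff_left_of_imp fun hc j hj => mem_descPos.2 (hc.ne_last j hj)

theorem autoChainOp_congr {φ : Perm (Perm (Fin (m + 1)))} (hφ : IsAuto φ)
    {f g : Perm (Fin (m + 1)) → M} {u : Perm (Fin (m + 1))}
    (h : ∀ p, BruhatLE u p → (φ p) (last m) ≤ (φ u) (last m) → f p = g p) :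
    autoChainOp q φ f u = autoChainOp q φ g u := by
  classical
  rw [autoChainOp_apply q hφ, autoChainOp_apply q hφ]
  refine Finset.sum_congr rfl fun p _ => ?_
  split_ifs with hc
  · obtain ⟨c, hc⟩ := hc
    rw [h p (hφ.le_iff.1 hc.walk.le) hc.walk.le.last_le]
  · rfl

end Operators

/-! ### Double shortcuts as composites of chain operators -/

section DoubleShortcuts

variable {m : ℕ}

open Fin (last)

/-- The endomorphism of `Multiset (ℕ × α)` that increases the first components by one. -/
def shift (α : Type*) : AddMonoid.End (Multiset (ℕ × α)) :=
  Multiset.mapAddMonoidHom fun e => (e.1 + 1, e.2)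

theorem shift_pow_singleton {α : Type*} (k l : ℕ) (a : α) :
    (shift α ^ k) {(l, a)} = {(k + l, a)} := by
  induction k with
  | zero => simp
  | succ k ih =>
    rw [pow_succ']
    change shift α ((shift α ^ k) {(l, a)}) = _
    rw [ih]
    refine (Multiset.map_singleton _ _).trans ?_
    rw [Nat.add_right_comm]

open scoped Classical in
/-- The double shortcuts for the minima singled out by `φ` and `ψ`, with values in an arbitrary
monoid. -/
noncomputable def doubleSum {M : Type*} [AddCommMonoid M] (q : AddMonoid.End M)
    (φ ψ : Perm (Perm (Fin (m + 1)))) (δ : Perm (Fin (m + 1)) → M) (u v : Perm (Fin (m + 1))) :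
    M :=
  autoChainOp q φ (fun p => if φ p (last m) = φ v (last m) then
    autoChainOp q ψ (fun b => if BruhatLE b v ∧ ψ b (last m) = ψ v (last m) then δ b else 0) p
    else 0) u

theorem IsLastMin.mem_auto_shortcuts_iff {φ : Perm (Perm (Fin (m + 1)))} (hφ : IsAuto φ)
    {u v z p : Perm (Fin (m + 1))} (hz : IsLastMin (φ u) (φ v) (φ z)) :
    p ∈ shortcuts u v z ↔ BruhatLE p v ∧ φ p (last m) = φ v (last m) ∧
      ∃ c, Chain c (φ u) (φ p) := by
  rw [← hφ.mem_shortcuts_iff, hz.mem_shortcuts_iff, hφ.le_iff]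

theorem IsLastMin.auto_isJoin_iff {φ : Perm (Perm (Fin (m + 1)))} (hφ : IsAuto φ)
    {u v z x w : Perm (Fin (m + 1))} (hz : IsLastMin (φ u) (φ v) (φ z)) (hx : x ∈ interval u v) :
    IsJoin v z x w ↔ IsLastMin (φ x) (φ v) (φ w) := by
  rw [← hz.isJoin_iff (hφ.mem_interval_iff.2 hx), IsJoin, IsJoin, hφ.isMinimum_iff]
  simp only [Set.preimage_inter]
  have h : ∀ a b, φ ⁻¹' (interval (φ a) (φ b)) = interval a b := fun a b => by
    ext y
    exact hφ.mem_interval_iff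
  rw [h, h]

theorem IsLastMin.hasJoins {φ : Perm (Perm (Fin (m + 1)))} (hφ : IsAuto φ)
    {u v z : Perm (Fin (m + 1))} (hz : IsLastMin (φ u) (φ v) (φ z)) : HasJoins u v z := by
  intro x hx
  obtain ⟨w, hw⟩ := exists_isLastMin (hφ.le_iff.2 hx.2)
  exact ⟨φ.symm w, (hz.auto_isJoin_iff hφ hx).2 (by simpa using hw)⟩

/-- The join of `z'` with `p` is again a minimum of the type handled by `ψ`, now for `[p, v]`, so
the second shortcut condition asks for a chain starting at `p`. The weight `shift` adds up the
lengths of the two chains. -/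
theorem DS_eq_doubleSum {φ ψ : Perm (Perm (Fin (m + 1)))} (hφ : IsAuto φ) (hψ : IsAuto ψ)
    {u v z z' : Perm (Fin (m + 1))} (hz : IsLastMin (φ u) (φ v) (φ z))
    (hz' : IsLastMin (ψ u) (ψ v) (ψ z')) :
    DS u v z z' = doubleSum (shift _) φ ψ (fun b => {(0, b)}) u v := by
  classical
  have hmem : ∀ p b, (p ∈ shortcuts u v z ∧ ∃ w, IsJoin v z' p w ∧ b ∈ shortcuts p v w) ↔
      (∃ c, Chain c (φ u) (φ p)) ∧ φ p (last m) = φ v (last m) ∧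
        (∃ c, Chain c (ψ p) (ψ b)) ∧ BruhatLE b v ∧ ψ b (last m) = ψ v (last m) := by
    intro p b
    constructor
    · rintro ⟨hp, w, hw, hb⟩
      rw [hz.mem_auto_shortcuts_iff hφ] at hp
      obtain ⟨hpv, hpl, c, hc⟩ := hp
      have hup : p ∈ interval u v := ⟨hφ.le_iff.1 hc.walk.le, hpv⟩
      rw [hz'.auto_isJoin_iff hψ hup] at hw
      rw [hw.mem_auto_shortcuts_iff hψ] at hb
      exact ⟨⟨c, hc⟩, hpl, hb.2.2, hb.1, hb.2.1⟩
    · rintro ⟨⟨c, hc⟩, hpl, ⟨d, hd⟩, hbv, hbl⟩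
      have hpv : BruhatLE p v := (hψ.le_iff.1 hd.walk.le).trans hbv
      have hup : p ∈ interval u v := ⟨hφ.le_iff.1 hc.walk.le, hpv⟩
      obtain ⟨w, hw⟩ := hz'.hasJoins hψ p hup
      refine ⟨(hz.mem_auto_shortcuts_iff hφ).2 ⟨hpv, hpl, c, hc⟩, w, hw, ?_⟩
      rw [hz'.auto_isJoin_iff hψ hup] at hw
      exact (hw.mem_auto_shortcuts_iff hψ).2 ⟨hbv, hbl, d, hd⟩
  have h1 : DS u v z z' = ∑ e : Perm (Fin (m + 1)) × Perm (Fin (m + 1)),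
      if e.1 ∈ shortcuts u v z ∧ ∃ w, IsJoin v z' e.1 w ∧ e.2 ∈ shortcuts e.1 v w
      then {(dist u e.1 + dist e.1 e.2, e.2)} else 0 := by
    rw [← Finset.sum_filter, DS, Finset.sum, ← Multiset.sum_map_singleton (Multiset.map _ _),
      Multiset.map_map]
    congr!
  rw [h1, doubleSum, autoChainOp_apply _ hφ, Fintype.sum_prod_type]
  refine Finset.sum_congr rfl fun p _ => ?_
  simp only [hmem]
  by_cases hc : ∃ c, Chain c (φ u) (φ p)
  · by_cases hl : φ p (last m) = φ v (last m)
    · rw [if_pos hc, if_pos hl, autoChainOp_apply _ hψ, map_sum]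
      refine Finset.sum_congr rfl fun b _ => ?_
      by_cases hd : ∃ c, Chain c (ψ p) (ψ b)
      · by_cases hb : BruhatLE b v ∧ ψ b (last m) = ψ v (last m)
        · rw [if_pos ⟨hc, hl, hd, hb⟩, if_pos hd, if_pos hb, shift_pow_singleton,
            shift_pow_singleton, add_zero]
        · rw [if_neg fun h => hb h.2.2.2, if_pos hd, if_neg hb, map_zero, map_zero]
      · rw [if_neg fun h => hd h.2.2.1, if_neg hd, map_zero]
    · rw [if_pos hc, if_neg hl, map_zero]
      exact Finset.sum_eq_zero fun b _ => if_neg fun h => hl h.2.1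
  · rw [if_neg hc]
    exact Finset.sum_eq_zero fun b _ => if_neg fun h => hc h.1

/-- A common automorphism `χ` can be absorbed into `u`, `v` and `δ`, so only two pairs of
automorphisms need to be studied. -/
theorem doubleSum_trans {M : Type*} [AddCommMonoid M] (q : AddMonoid.End M)
    {χ : Perm (Perm (Fin (m + 1)))} (hχ : IsAuto χ) (φ ψ : Perm (Perm (Fin (m + 1))))
    (δ : Perm (Fin (m + 1)) → M) (u v : Perm (Fin (m + 1))) :
    doubleSum q (χ.trans φ) (χ.trans ψ) δ u v = doubleSum q φ ψ (δ ∘ χ.symm) (χ u) (χ v) := by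
  classical
  have h : ∀ b, BruhatLE (χ.symm b) v ↔ BruhatLE b (χ v) := fun b => by
    rw [← hχ.le_iff, χ.apply_symm_apply]
  simp only [doubleSum, autoChainOp, Function.comp_def, Equiv.trans_apply, Equiv.symm_trans_apply,
    Equiv.apply_symm_apply, h]

end DoubleShortcuts

/-! ### Yang–Baxter relations -/

section YangBaxter

variable {n m : ℕ} {M : Type*} [AddCommMonoid M] (q : AddMonoid.End M)

open Fin (last)

/-- Only the relative order of `x i`, `x j`, `x k` matters. For each of the six orders both sides
expand to the same terms, once products of two transpositions are brought to a normal form by `e1`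
to `e5`. -/
theorem swapOp_yangBaxter {i j k : Fin n} (hij : i ≠ j) (hik : i ≠ k) (hjk : j ≠ k) :
    swapOp q j k * swapOp q i k * swapOp q i j = swapOp q i j * swapOp q i k * swapOp q j k := by
  funext f x
  have e1 : ∀ y : Perm (Fin n), y * Equiv.swap i j * Equiv.swap j k =
      y * Equiv.swap j k * Equiv.swap i k := fun y => by
    rw [mul_assoc, mul_assoc, swap_mul_swap_conj j k, Equiv.swap_apply_right,
      Equiv.swap_apply_of_ne_of_ne hij hik]
  have e2 : ∀ y : Perm (Fin n), y * Equiv.swap i k * Equiv.swap i j =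
      y * Equiv.swap j k * Equiv.swap i k := fun y => by
    rw [mul_assoc, mul_assoc, swap_mul_swap_conj i k, Equiv.swap_apply_left,
      Equiv.swap_apply_of_ne_of_ne hij.symm hjk, Equiv.swap_comm k j]
  have e3 : ∀ y : Perm (Fin n), y * Equiv.swap i k * Equiv.swap j k =
      y * Equiv.swap j k * Equiv.swap i j := fun y => by
    rw [mul_assoc, mul_assoc, swap_mul_swap_conj j k i, Equiv.swap_apply_left,
      Equiv.swap_apply_of_ne_of_ne hij hik]
  have e4 : ∀ y : Perm (Fin n), y * Equiv.swap i j * Equiv.swap i k =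
      y * Equiv.swap j k * Equiv.swap i j := fun y => by
    rw [mul_assoc, mul_assoc, swap_mul_swap_conj i j, Equiv.swap_apply_left,
      Equiv.swap_apply_of_ne_of_ne hik.symm hjk.symm]
  have e5 : ∀ y : Perm (Fin n), y * Equiv.swap j k * Equiv.swap j k = y := fun y => by
    rw [mul_assoc, Equiv.swap_mul_self, mul_one]
  simp only [End.mul_apply, swapOp_apply, Perm.mul_apply, Equiv.swap_apply_left,
    Equiv.swap_apply_right, Equiv.swap_apply_of_ne_of_ne hij hik,
    Equiv.swap_apply_of_ne_of_ne hij.symm hjk, Equiv.swap_apply_of_ne_of_ne hik.symm hjk.symm]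
  have h1 : x i ≠ x j := fun h => hij (x.injective h)
  have h2 : x i ≠ x k := fun h => hik (x.injective h)
  have h3 : x j ≠ x k := fun h => hjk (x.injective h)
  simp only [e1, e2, e3, e4, e5]
  rcases lt_or_gt_of_ne h1 with h1 | h1 <;> rcases lt_or_gt_of_ne h2 with h2 | h2 <;>
    rcases lt_or_gt_of_ne h3 with h3 | h3 <;>
    first
    | exact absurd (h1.trans h3) h2.not_gt
    | exact absurd (h3.trans h1) h2.not_gt
    | (simp only [h1, h2, h3, h1.not_gt, h2.not_gt, h3.not_gt, if_true, if_false, add_zero,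
        map_add]
       try abel)

theorem swapOp_commute {i j k l : Fin n} (hik : i ≠ k) (hil : i ≠ l) (hjk : j ≠ k)
    (hjl : j ≠ l) : Commute (swapOp q i j (M := M)) (swapOp q k l) := by
  funext f x
  have e : x * Equiv.swap k l * Equiv.swap i j = x * Equiv.swap i j * Equiv.swap k l := by
    rw [mul_assoc, mul_assoc, swap_mul_swap_conj k l, Equiv.swap_apply_of_ne_of_ne hik hil,
      Equiv.swap_apply_of_ne_of_ne hjk hjl]
  simp only [End.mul_apply, swapOp_apply, Perm.mul_apply, e,
    Equiv.swap_apply_of_ne_of_ne hik hil, Equiv.swap_apply_of_ne_of_ne hjk hjl,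
    Equiv.swap_apply_of_ne_of_ne hik.symm hjk.symm, Equiv.swap_apply_of_ne_of_ne hil.symm hjl.symm]
  split_ifs <;> simp only [map_add, add_zero]
  abel

/-- Abstract form of the exchange: the relation `h` swaps the factors with index `j` across `c`,
after which they commute with all factors of other indices and can be moved to the outside. -/
theorem prod_reverse_mul_mul_prod {G ι : Type*} [Monoid G] (a b : ι → G) (c : G) (l : List ι)
    (hl : l.Nodup) (h : ∀ i ∈ l, a i * c * b i = b i * c * a i)
    (hc : ∀ i ∈ l, ∀ j ∈ l, i ≠ j → Commute (a i) (b j)) :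
    (l.reverse.map a).prod * c * (l.map b).prod = (l.map b).prod * c * (l.reverse.map a).prod := by
  induction l with
  | nil => simp
  | cons j l ih =>
    obtain ⟨hj, hl⟩ := List.nodup_cons.1 hl
    have ih := ih hl (fun i hi => h i (List.mem_cons_of_mem _ hi)) fun i hi k hk =>
      hc i (List.mem_cons_of_mem _ hi) k (List.mem_cons_of_mem _ hk)
    have h1 : Commute (l.reverse.map a).prod (b j) := by
      refine Commute.list_prod_left _ _ fun x hx => ?_
      obtain ⟨i, hi, rfl⟩ := List.mem_map.1 hx
      rw [List.mem_reverse] at hi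
      exact hc i (List.mem_cons_of_mem _ hi) j List.mem_cons_self (by rintro rfl; exact hj hi)
    have h2 : Commute (a j) (l.map b).prod := by
      refine Commute.list_prod_right _ _ fun x hx => ?_
      obtain ⟨i, hi, rfl⟩ := List.mem_map.1 hx
      exact hc j List.mem_cons_self i (List.mem_cons_of_mem _ hi) (by rintro rfl; exact hj hi)
    have h3 := h j List.mem_cons_self
    simp only [List.reverse_cons, List.map_append, List.map_cons, List.map_nil, List.prod_append,
      List.prod_cons, List.prod_nil, mul_one]
    set A := (l.reverse.map a).prod
    set B := (l.map b).prod
    calc A * a j * c * (b j * B) = A * (a j * c * b j) * B := by simp only [mul_assoc]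
      _ = A * b j * c * (a j * B) := by rw [h3]; simp only [mul_assoc]
      _ = b j * (A * c * B) * a j := by rw [h1.eq, h2.eq]; simp only [mul_assoc]
      _ = b j * B * c * (A * a j) := by rw [ih]; simp only [mul_assoc]

/-- Restriction of a function to the permutations `x` with `x c = r`. -/
def restrictOp (M : Type*) [AddCommMonoid M] (c r : Fin n) : Function.End (Perm (Fin n) → M) :=
  fun f x => if x c = r then f x else 0

theorem restrictOp_commute {c r i j : Fin n} (hi : c ≠ i) (hj : c ≠ j) :
    Commute (restrictOp M c r) (swapOp q i j) := by
  funext f x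
  simp only [End.mul_apply, swapOp_apply, restrictOp, Perm.mul_apply,
    Equiv.swap_apply_of_ne_of_ne hi hj]
  split_ifs <;> simp

/-- The positions other than the first and the last one, in increasing order. -/
def midPos (m : ℕ) : List (Fin (m + 2)) := (List.finRange m).map fun i => i.castSucc.succ

theorem mem_midPos {i : Fin (m + 2)} (h : i ∈ midPos m) : i ≠ 0 ∧ i ≠ last (m + 1) := by
  obtain ⟨j, -, rfl⟩ := List.mem_map.1 h
  refine ⟨Fin.succ_ne_zero _, ?_⟩
  rw [← Fin.castSucc_succ]
  exact Fin.castSucc_ne_last _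

theorem nodup_midPos : (midPos m).Nodup :=
  (List.nodup_finRange m).map fun i j h => by simpa using h

theorem chainOp_eq_mid : chainOp q (M := M) =
    ((midPos m).reverse.map fun i => swapOp q i (last (m + 1))).prod *
      swapOp q 0 (last (m + 1)) := by
  have : descPos (m + 1) = (midPos m).reverse ++ [0] := by
    rw [descPos, List.finRange_succ, List.map_cons, List.map_map, List.reverse_cons, midPos]
    rfl
  rw [chainOp, this, List.map_append, List.prod_append]
  simp

/-- Conjugation by the longest element reverses the positions: chains now exchange the first letter
with letters at increasing positions, and the last position comes at the end. -/
theorem autoChainOp_revConj : autoChainOp q (M := M) (revConj (m + 2)) =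
    ((midPos m).map fun i => swapOp q 0 i).prod * swapOp q 0 (last (m + 1)) := by
  have key : ∀ (l : List (Fin (m + 2))) (f : Perm (Fin (m + 2)) → M) (u : Perm (Fin (m + 2))),
      (l.map fun i => swapOp q i (last (m + 1))).prod (f ∘ (revConj (m + 2)).symm)
        (revConj (m + 2) u) = (l.map fun i => swapOp q 0 i.rev).prod f u := by
    intro l f
    induction l with
    | nil => exact fun u => congrArg f ((revConj (m + 2)).symm_apply_apply u)
    | cons i l ih =>
      intro u
      have h : revConj (m + 2) u * Equiv.swap i (last (m + 1)) =
          revConj (m + 2) (u * Equiv.swap 0 i.rev) := by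
        rw [revConj_mul, revConj_swap, Fin.rev_rev, Fin.rev_zero, Equiv.swap_comm]
      simp only [List.map_cons, List.prod_cons, End.mul_apply, swapOp_apply, h, ih,
        revConj_apply, Fin.rev_last, Fin.rev_lt_rev]
  have hl : (descPos (m + 1)).map Fin.rev = midPos m ++ [last (m + 1)] := by
    rw [descPos, ← List.map_reverse, List.map_map, List.finRange_reverse, List.map_map]
    have : (Fin.rev ∘ Fin.castSucc) ∘ Fin.rev = (Fin.succ : Fin (m + 1) → Fin (m + 2)) := by
      funext i
      simp [Fin.rev_castSucc]
    rw [this, List.finRange_succ_last, List.map_append, List.map_map]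
    rfl
  funext f u
  rw [autoChainOp, chainOp, key]
  have : (descPos (m + 1)).map (fun i => swapOp q (M := M) 0 i.rev) =
      ((descPos (m + 1)).map Fin.rev).map fun i => swapOp q 0 i := by
    rw [List.map_map]
    rfl
  rw [this, hl, List.map_append, List.prod_append]
  simp

theorem autoChainOp_refl : autoChainOp q (M := M) (Equiv.refl (Perm (Fin (m + 1)))) = chainOp q :=
  rfl

/-- With `C` the operator of the pair of extreme positions, the two chain operators are `A * C` and
`B * C`. The restriction on the last letter commutes with `B` and the one on the first letter with
`A`. What remains is `A * C * B = B * C * A`, applied to the same function `f` on both sides. -/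
theorem doubleSum_revConj (δ : Perm (Fin (m + 2)) → M) (u v : Perm (Fin (m + 2))) :
    doubleSum q (Equiv.refl _) (revConj (m + 2)) δ u v =
      doubleSum q (revConj (m + 2)) (Equiv.refl _) δ u v := by
  classical
  set A := ((midPos m).reverse.map fun i => swapOp q (M := M) i (last (m + 1))).prod with hA
  set B := ((midPos m).map fun i => swapOp q (M := M) 0 i).prod with hB
  set C := swapOp q (M := M) 0 (last (m + 1)) with hC
  have hAB : A * C * B = B * C * A := by
    refine prod_reverse_mul_mul_prod (fun i => swapOp q i (last (m + 1))) (fun i => swapOp q 0 i)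
      C (midPos m) nodup_midPos (fun i hi => ?_) fun i hi j hj hij => ?_
    · obtain ⟨h1, h2⟩ := mem_midPos hi
      exact swapOp_yangBaxter q h1.symm (Fin.last_pos).ne h2
    · obtain ⟨h1, h2⟩ := mem_midPos hi
      obtain ⟨h3, h4⟩ := mem_midPos hj
      exact swapOp_commute q h1 hij (Fin.last_pos).ne' h4.symm
  have hBr : Commute (restrictOp M (last (m + 1)) (v (last (m + 1)))) B := by
    refine Commute.list_prod_right _ _ fun x hx => ?_
    obtain ⟨i, hi, rfl⟩ := List.mem_map.1 hx
    exact restrictOp_commute q (Fin.last_pos).ne' (mem_midPos hi).2.symm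
  have hAr : Commute (restrictOp M 0 (v 0)) A := by
    refine Commute.list_prod_right _ _ fun x hx => ?_
    obtain ⟨i, hi, rfl⟩ := List.mem_map.1 hx
    exact restrictOp_commute q (mem_midPos (List.mem_reverse.1 hi)).1.symm (Fin.last_pos).ne
  have hrev : ∀ b, revConj (m + 2) b (last (m + 1)) = revConj (m + 2) v (last (m + 1)) ↔
      b 0 = v 0 := fun b => by simp [revConj_apply]
  set f : Perm (Fin (m + 2)) → M := fun b =>
    if BruhatLE b v ∧ b 0 = v 0 ∧ b (last (m + 1)) = v (last (m + 1)) then δ b else 0 with hf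
  have h1 : restrictOp M (last (m + 1)) (v (last (m + 1)))
      (C fun b => if BruhatLE b v ∧ b 0 = v 0 then δ b else 0) = f := by
    funext y
    simp only [restrictOp, hC, swapOp_apply, hf]
    by_cases hy : y (last (m + 1)) = v (last (m + 1))
    · have : ¬ (y 0 < y (last (m + 1)) ∧ BruhatLE (y * Equiv.swap 0 (last (m + 1))) v) := by
        rintro ⟨h1, h2⟩
        have := h2.last_le
        simp only [Perm.mul_apply, Equiv.swap_apply_right] at this
        exact absurd (this.trans_lt h1) hy.not_gt
      rw [not_and] at this
      simp only [hy, if_true, and_true]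
      split_ifs with h2 h3 h4 <;> simp_all
    · simp [hy]
  have h2 : restrictOp M 0 (v 0)
      (C fun b => if BruhatLE b v ∧ b (last (m + 1)) = v (last (m + 1)) then δ b else 0) = f := by
    funext y
    simp only [restrictOp, hC, swapOp_apply, hf]
    by_cases hy : y 0 = v 0
    · have : ¬ (y 0 < y (last (m + 1)) ∧ BruhatLE (y * Equiv.swap 0 (last (m + 1))) v) := by
        rintro ⟨h1, h2⟩
        have := (isAuto_revConj.le_iff.2 h2).last_le
        simp only [revConj_apply, Fin.rev_last, Perm.mul_apply, Equiv.swap_apply_left,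
          Fin.rev_le_rev] at this
        exact absurd (h1.trans_le this) hy.not_lt
      rw [not_and] at this
      simp only [hy, if_true, true_and]
      split_ifs with h2 h3 h4 <;> simp_all
    · simp [hy]
  have h3 : doubleSum q (Equiv.refl _) (revConj (m + 2)) δ u v =
      (A * C * (restrictOp M (last (m + 1)) (v (last (m + 1))) * (B * C)))
        (fun b => if BruhatLE b v ∧ b 0 = v 0 then δ b else 0) u := by
    simp only [doubleSum, autoChainOp_refl, autoChainOp_revConj, chainOp_eq_mid, hrev]
    rfl
  have h4 : doubleSum q (revConj (m + 2)) (Equiv.refl _) δ u v =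
      (B * C * (restrictOp M 0 (v 0) * (A * C)))
        (fun b => if BruhatLE b v ∧ b (last (m + 1)) = v (last (m + 1)) then δ b else 0) u := by
    simp only [doubleSum, autoChainOp_refl, autoChainOp_revConj, chainOp_eq_mid, hrev]
    rfl
  rw [h3, h4, ← mul_assoc (restrictOp _ _ _), hBr.eq, ← mul_assoc (restrictOp _ _ _), hAr.eq]
  have h5 : ∀ (X Y Z C : Function.End (Perm (Fin (m + 2)) → M)) g, (X * (Y * Z * C)) g =
      (X * Y) (Z (C g)) := fun X Y Z C g => rfl
  rw [h5, h5, h1, h2, hAB]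

end YangBaxter

/-! ### Commuting left and right operators -/

section Hecke

variable {n m : ℕ} {M : Type*} [AddCommMonoid M] (q : AddMonoid.End M)

open Fin (last)

/-- The simple transposition exchanging `i` and `i + 1`. -/
def simpleSwap (i : Fin m) : Perm (Fin (m + 1)) := Equiv.swap i.castSucc i.succ

/-- Right multiplication of the argument by `w`. -/
def rightOp (M : Type*) (w : Perm (Fin n)) : Function.End (Perm (Fin n) → M) :=
  fun f x => f (x * w)

/-- Inversion of the argument. -/
def invOp (M : Type*) (n : ℕ) : Function.End (Perm (Fin n) → M) := fun f x => f x⁻¹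

/-- The right action of (the inverse of) a generator of the Hecke algebra, on functions. -/
def heckeOp (i : Fin m) : Function.End (Perm (Fin (m + 1)) → M) :=
  swapOp q i.castSucc i.succ * rightOp M (simpleSwap i)

theorem heckeOp_apply (i : Fin m) (f : Perm (Fin (m + 1)) → M) (x : Perm (Fin (m + 1))) :
    heckeOp q i f x =
      f (x * simpleSwap i) + if x i.castSucc < x i.succ then q (f x) else 0 := by
  simp only [heckeOp, End.mul_apply, swapOp_apply, rightOp, simpleSwap, mul_assoc,
    Equiv.swap_mul_self, mul_one]

theorem rightOp_mul_swapOp (w : Perm (Fin n)) (a b : Fin n) :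
    rightOp M w * swapOp q a b = swapOp q (w a) (w b) * rightOp M w := by
  funext f x
  simp only [End.mul_apply, swapOp_apply, rightOp, Perm.mul_apply]
  rw [mul_assoc x w, Equiv.mul_swap_eq_swap_mul, mul_assoc]
  rfl

theorem rightOp_mul_rightOp {N : Type*} (w w' : Perm (Fin n)) :
    rightOp N w * rightOp N w' = rightOp N (w * w') := by
  funext f x
  simp only [End.mul_apply, rightOp, mul_assoc]

theorem invOp_mul_invOp {N : Type*} : invOp N n * invOp N n = 1 := by
  funext f x
  exact congrArg f (inv_inv x)

theorem simpleSwap_apply_lt_iff {j : Fin m} {a b : Fin (m + 1)}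
    (h : ¬ (a = j.castSucc ∧ b = j.succ)) (h' : ¬ (a = j.succ ∧ b = j.castSucc)) :
    simpleSwap j a < simpleSwap j b ↔ a < b := by
  simp only [simpleSwap, Equiv.swap_apply_def, Fin.lt_def, Fin.ext_iff] at *
  split_ifs <;> simp only [Fin.val_castSucc, Fin.val_succ] at * <;> omega

/-- One operator acts by multiplication on the right, the other on the left. Either `s_j x = x s_i`,
and both composites are computed directly, or neither multiplication affects the comparison made by
the other operator. -/
theorem heckeOp_commute (i j : Fin m) :
    Commute (heckeOp q (M := M) i) (invOp M (m + 1) * heckeOp q j * invOp M (m + 1)) := by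
  funext f x
  have hs : ∀ k : Fin m, (simpleSwap k)⁻¹ = simpleSwap k := fun k => Equiv.swap_inv _ _
  have hl : ∀ k : Fin m, simpleSwap k k.castSucc = k.succ := fun k => Equiv.swap_apply_left _ _
  have hr : ∀ k : Fin m, simpleSwap k k.succ = k.castSucc := fun k => Equiv.swap_apply_right _ _
  have hlt : ∀ k : Fin m, k.castSucc < k.succ := fun k => Fin.castSucc_lt_succ
  simp only [End.mul_apply, heckeOp_apply, invOp, mul_inv_rev, inv_inv, hs, Perm.mul_apply,
    mul_assoc, map_add]
  by_cases h1 : x i.castSucc = j.castSucc ∧ x i.succ = j.succ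
  · have h2 : x⁻¹ j.castSucc = i.castSucc := by rw [Perm.inv_eq_iff_eq, h1.1]
    have h3 : x⁻¹ j.succ = i.succ := by rw [Perm.inv_eq_iff_eq, h1.2]
    have h4 : simpleSwap j * x = x * simpleSwap i := by
      rw [simpleSwap, simpleSwap, Equiv.mul_swap_eq_swap_mul, h1.1, h1.2]
    simp only [h1.1, h1.2, h2, h3, hl, hr, hlt, (hlt _).not_gt, if_true, if_false, add_zero, h4]
  by_cases h1' : x i.castSucc = j.succ ∧ x i.succ = j.castSucc
  · have h2 : x⁻¹ j.succ = i.castSucc := by rw [Perm.inv_eq_iff_eq, h1'.1]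
    have h3 : x⁻¹ j.castSucc = i.succ := by rw [Perm.inv_eq_iff_eq, h1'.2]
    have h4 : simpleSwap j * x = x * simpleSwap i := by
      rw [simpleSwap, simpleSwap, Equiv.mul_swap_eq_swap_mul, h1'.1, h1'.2, Equiv.swap_comm]
    simp only [h1'.1, h1'.2, h2, h3, hl, hr, hlt, (hlt _).not_gt, if_true, if_false, add_zero, h4]
  · have h2 : simpleSwap j (x i.castSucc) < simpleSwap j (x i.succ) ↔ x i.castSucc < x i.succ :=
      simpleSwap_apply_lt_iff h1 h1'
    have h3 : simpleSwap i (x⁻¹ j.castSucc) < simpleSwap i (x⁻¹ j.succ) ↔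
        x⁻¹ j.castSucc < x⁻¹ j.succ := by
      refine simpleSwap_apply_lt_iff ?_ ?_
      · rw [Perm.inv_eq_iff_eq, Perm.inv_eq_iff_eq]
        exact fun h => h1 ⟨h.1.symm, h.2.symm⟩
      · rw [Perm.inv_eq_iff_eq, Perm.inv_eq_iff_eq]
        exact fun h => h1' ⟨h.2.symm, h.1.symm⟩
    simp only [h2, h3]
    split_ifs <;> try simp only [map_zero, add_zero]
    all_goals try abel

/-- The product of the operators `heckeOp` for a Coxeter element. -/
def heckeProd : Function.End (Perm (Fin (m + 1)) → M) :=
  ((List.finRange m).reverse.map fun i => heckeOp q i).prod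

theorem heckeProd_commute :
    Commute (heckeProd q (m := m) (M := M))
      (invOp M (m + 1) * heckeProd q * invOp M (m + 1)) := by
  have h : ∀ l : List (Fin m),
      (l.map fun i => invOp M (m + 1) * heckeOp q i * invOp M (m + 1)).prod =
        invOp M (m + 1) * (l.map fun i => heckeOp q i).prod * invOp M (m + 1) := by
    intro l
    induction l with
    | nil => simp [invOp_mul_invOp]
    | cons i l ih =>
      rw [List.map_cons, List.prod_cons, List.map_cons, List.prod_cons, ih]
      simp only [mul_assoc]
      rw [← mul_assoc (invOp M _) (invOp M _), invOp_mul_invOp, one_mul]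
  rw [heckeProd, ← h]
  refine Commute.list_prod_left _ _ fun x hx => Commute.list_prod_right _ _ fun y hy => ?_
  obtain ⟨i, -, rfl⟩ := List.mem_map.1 hx
  obtain ⟨j, -, rfl⟩ := List.mem_map.1 hy
  exact heckeOp_commute q i j

/-- The simple transpositions in the operators are collected and moved to the right. They relabel
the indices of the operators they pass: `w` records those already collected, and the conditions on
it turn the pair `(i, i + 1)` into `(i, last m)`. -/
theorem rightOp_mul_prod_heckeOp (k : ℕ) (hk : k ≤ m) :
    ∃ c : Perm (Fin (m + 1)), c 0 = ⟨k, by omega⟩ ∧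
      (∀ j : Fin m, (j : ℕ) < k → c j.succ = j.castSucc) ∧
      (∀ j : Fin m, k ≤ (j : ℕ) → c j.succ = j.succ) ∧
      ∀ w : Perm (Fin (m + 1)), w ⟨k, by omega⟩ = last m →
        (∀ j : Fin (m + 1), (j : ℕ) < k → w j = j) →
        rightOp M w * (((List.finRange m).take k).reverse.map fun i => heckeOp q i).prod =
          (((List.finRange m).take k).reverse.map fun i => swapOp q i.castSucc (last m)).prod *
            rightOp M (w * c) := by
  induction k with
  | zero => exact ⟨1, rfl, by simp, by simp, by simp⟩
  | succ k ih =>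
    obtain ⟨c, h0, h1, h2, h3⟩ := ih (by omega)
    set i : Fin m := ⟨k, by omega⟩ with hi
    have hic : (⟨k, by omega⟩ : Fin (m + 1)) = i.castSucc := rfl
    have his : (⟨k + 1, by omega⟩ : Fin (m + 1)) = i.succ := rfl
    have ht : (List.finRange m).take (k + 1) = (List.finRange m).take k ++ [i] := by
      rw [List.take_add_one]
      simp [hi, show k < m by omega]
    refine ⟨simpleSwap i * c, ?_, fun j hj => ?_, fun j hj => ?_, fun w hw hw' => ?_⟩
    · rw [Perm.mul_apply, h0, hic, his, simpleSwap, Equiv.swap_apply_left]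
    · rcases Nat.lt_succ_iff_lt_or_eq.1 hj with hj | hj
      · rw [Perm.mul_apply, h1 j hj, simpleSwap, Equiv.swap_apply_of_ne_of_ne]
        · simp [Fin.ext_iff, hi]; omega
        · simp [Fin.ext_iff, hi]; omega
      · have hji : j = i := Fin.ext hj
        rw [Perm.mul_apply, h2 j hj.ge, hji, simpleSwap, Equiv.swap_apply_right]
    · rw [Perm.mul_apply, h2 j (by omega), simpleSwap, Equiv.swap_apply_of_ne_of_ne]
      · simp [Fin.ext_iff, hi]; omega
      · simp [Fin.ext_iff, hi]; omega
    · have h4 := h3 (w * simpleSwap i)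
        (by rw [Perm.mul_apply, hic, simpleSwap, Equiv.swap_apply_left, ← his, hw]) (by
          intro j hj
          rw [Perm.mul_apply, simpleSwap, Equiv.swap_apply_of_ne_of_ne, hw' j (by omega)]
          · simp [Fin.ext_iff, hi]; omega
          · simp [Fin.ext_iff, hi]; omega)
      rw [ht, List.reverse_append]
      simp only [List.reverse_cons, List.reverse_nil, List.nil_append, List.cons_append,
        List.map_cons, List.prod_cons]
      rw [heckeOp, ← mul_assoc, ← mul_assoc, rightOp_mul_swapOp, mul_assoc (swapOp _ _ _),
        rightOp_mul_rightOp, mul_assoc, h4, ← his, hw, hw' _ (by simp [hi]), ← mul_assoc,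
        mul_assoc w]

theorem heckeProd_eq : ∃ c : Perm (Fin (m + 1)), c 0 = last m ∧
    (∀ j : Fin m, c j.succ = j.castSucc) ∧
    heckeProd q (M := M) = chainOp q * rightOp M c := by
  obtain ⟨c, h0, h1, -, h2⟩ := rightOp_mul_prod_heckeOp q (M := M) m le_rfl
  refine ⟨c, h0, fun j => h1 j j.2, ?_⟩
  have h3 := h2 1 rfl fun j _ => rfl
  have h4 : (List.finRange m).take m = List.finRange m :=
    List.take_of_length_le (by simp)
  rw [h4, one_mul] at h3
  rw [chainOp, descPos, ← List.map_reverse, List.map_map]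
  exact h3

/-- Multiplication by `c⁻¹` turns the largest letter into the smallest and preserves the order of
the others. Since `g` only sees permutations with that letter at `r`, and the smallest letter, once
in last position, can never leave it, the letter must sit at `r` from the start and stay there. The
chains that avoid `r` contribute the same in both labellings. -/
theorem chainOp_apply_inv_mul {c : Perm (Fin (m + 1))} (h0 : c 0 = last m)
    (hc : ∀ j : Fin m, c j.succ = j.castSucc) {r : Fin (m + 1)} (hr : r ≠ last m)
    {g : Perm (Fin (m + 1)) → M} (hg : ∀ y, y r ≠ last m → g y = 0) (x : Perm (Fin (m + 1))) :
    chainOp q (fun y => g (c * y)) (c⁻¹ * x) = if x r = last m then chainOp q g x else 0 := by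
  have hcl : c⁻¹ (last m) = 0 := by rw [Perm.inv_eq_iff_eq, h0]
  have hcs : ∀ j : Fin m, c⁻¹ j.castSucc = j.succ := fun j => by rw [Perm.inv_eq_iff_eq, hc]
  have hclt : ∀ a b, a ≠ last m → b ≠ last m → (c⁻¹ a < c⁻¹ b ↔ a < b) := by
    intro a b ha hb
    obtain ⟨a, rfl⟩ := Fin.exists_castSucc_eq.2 ha
    obtain ⟨b, rfl⟩ := Fin.exists_castSucc_eq.2 hb
    rw [hcs, hcs, Fin.succ_lt_succ_iff, Fin.castSucc_lt_castSucc_iff]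
  suffices ∀ l : List (Fin (m + 1)), (∀ i ∈ l, i ≠ last m) → ∀ x,
      (l.map fun i => swapOp q i (last m)).prod (fun y => g (c * y)) (c⁻¹ * x) =
        if x r = last m then (l.map fun i => swapOp q i (last m)).prod g x else 0 from
    this _ (fun i hi => mem_descPos.1 hi) x
  intro l
  induction l with
  | nil =>
    intro _ x
    change g (c * (c⁻¹ * x)) = if x r = last m then g x else 0
    rw [mul_inv_cancel_left]
    split_ifs with h
    · rfl
    · exact hg x h
  | cons a l ih =>
    intro hl x
    have ha := hl a List.mem_cons_self
    have ih := ih fun i hi => hl i (List.mem_cons_of_mem _ hi)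
    simp only [List.map_cons, List.prod_cons, End.mul_apply, swapOp_apply]
    rw [mul_assoc, ih, ih, Perm.mul_apply, Perm.mul_apply, Perm.mul_apply]
    by_cases hx : x r = last m
    · simp only [hx, if_true]
      by_cases har : a = r
      · subst har
        have h1 : x (last m) ≠ last m := fun h => ha (x.injective (hx.trans h.symm))
        rw [Equiv.swap_apply_left, if_neg h1, map_zero, ite_self, hx,
          if_neg (Fin.le_last _).not_gt]
      · have h1 : x a ≠ last m := fun h => har (x.injective (h.trans hx.symm))
        have h2 : x (last m) ≠ last m := fun h => hr (x.injective (hx.trans h.symm))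
        rw [Equiv.swap_apply_of_ne_of_ne (Ne.symm har) hr, if_pos hx]
        simp only [hclt _ _ h1 h2]
    · simp only [hx, if_false, zero_add]
      by_cases har : a = r
      · subst har
        rw [Equiv.swap_apply_left]
        by_cases h1 : x (last m) = last m
        · rw [h1, hcl, if_neg (Fin.zero_le _).not_gt]
        · rw [if_neg h1, map_zero, ite_self]
      · rw [Equiv.swap_apply_of_ne_of_ne (Ne.symm har) hr, if_neg hx, map_zero, ite_self]

theorem chainOp_eq_self {g : Perm (Fin (m + 1)) → M}
    (hg : ∀ y, y (last m) ≠ last m → g y = 0) : chainOp q g = g := by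
  suffices ∀ l : List (Fin (m + 1)), (l.map fun i => swapOp q i (last m)).prod g = g from this _
  intro l
  induction l with
  | nil => rfl
  | cons a l ih =>
    rw [List.map_cons, List.prod_cons, End.mul_apply, ih]
    funext x
    rw [swapOp_apply]
    split_ifs with h
    · rw [hg (x * _), map_zero, add_zero]
      rw [Perm.mul_apply, Equiv.swap_apply_right]
      exact (h.trans_le (Fin.le_last _)).ne
    · exact add_zero _

/-- The relabelling by `c` that separates `chainOp` from `heckeProd` is exactly what creates the
restriction `p (last m) = r`, by `chainOp_apply_inv_mul` applied to `p⁻¹`. The composite with a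
restriction thus becomes a pure product of a right and a left Hecke operator, applied to a conjugate
of `f`. -/
theorem chainOp_restrict_inv {c : Perm (Fin (m + 1))} (h0 : c 0 = last m)
    (hc : ∀ j : Fin m, c j.succ = j.castSucc)
    (hp : heckeProd q (M := M) = chainOp q * rightOp M c) {r : Fin (m + 1)} (hr : r ≠ last m)
    {f : Perm (Fin (m + 1)) → M} (hf : ∀ y, y (last m) ≠ r → f y = 0) :
    chainOp q (fun p => if p (last m) = r then autoChainOp q (Equiv.inv _) f p else 0) =
      heckeProd q (invOp M _ (heckeProd q (invOp M _ fun y => f (c * y * c⁻¹)))) := by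
  rw [hp]
  simp only [End.mul_apply]
  congr 1
  funext p
  have h := chainOp_apply_inv_mul q h0 hc hr (g := f ∘ Inv.inv) (x := p⁻¹) (by
    intro y hy
    refine hf _ fun h => hy ?_
    exact (Perm.inv_eq_iff_eq.1 h).symm)
  have h1 : p⁻¹ r = last m ↔ p (last m) = r := by
    rw [Perm.inv_eq_iff_eq, eq_comm]
  simp only [h1] at h
  refine h.symm.trans ?_
  change chainOp q _ (c⁻¹ * p⁻¹) = chainOp q _ (p * c)⁻¹
  rw [mul_inv_rev]
  refine congrFun (congrArg (chainOp q) (funext fun y => ?_)) _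
  change f (c * y)⁻¹ = f (c * (y * c)⁻¹ * c⁻¹)
  rw [mul_inv_rev, mul_inv_rev, mul_inv_cancel_left]

/-- Both sides are products of the commuting operators of `heckeProd_commute`. They act on the same
function because conjugation by `c` commutes with inversion. -/
theorem chainOp_restrict_comm {r s : Fin (m + 1)} (hr : r ≠ last m) (hs : s ≠ last m)
    {f : Perm (Fin (m + 1)) → M} (hf : ∀ y, y (last m) ≠ r → f y = 0)
    (hf' : ∀ y, y⁻¹ (last m) ≠ s → f y = 0) (u : Perm (Fin (m + 1))) :
    chainOp q (fun p => if p (last m) = r then autoChainOp q (Equiv.inv _) f p else 0) u =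
      autoChainOp q (Equiv.inv _) (fun p => if p⁻¹ (last m) = s then chainOp q f p else 0) u := by
  obtain ⟨c, h0, hc, hp⟩ := heckeProd_eq q (m := m) (M := M)
  have h1 := chainOp_restrict_inv q h0 hc hp hr hf
  have h2 := chainOp_restrict_inv q h0 hc hp hs (f := f ∘ Inv.inv) fun y hy =>
    hf' _ (by rwa [inv_inv])
  have h3 := congrFun (heckeProd_commute q (m := m) (M := M)).eq fun y => f (c * y * c⁻¹)
  simp only [End.mul_apply] at h3
  rw [h1, h3]
  have h4 : (invOp M (m + 1) fun y => (f ∘ Inv.inv) (c * y * c⁻¹)) =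
      fun y => f (c * y * c⁻¹) := by
    funext y
    simp only [invOp, Function.comp_apply, mul_inv_rev, inv_inv, mul_assoc]
  rw [h4] at h2
  refine (congrFun h2 u⁻¹).symm.trans ?_
  have h6 : ∀ g : Perm (Fin (m + 1)) → M, autoChainOp q (Equiv.inv _) g =
      chainOp q (g ∘ Inv.inv) ∘ Inv.inv := fun g => rfl
  simp only [h6, Function.comp_def, inv_inv]

theorem doubleSum_inv (δ : Perm (Fin (m + 1)) → M) (u v : Perm (Fin (m + 1))) :
    doubleSum q (Equiv.refl _) (Equiv.inv _) δ u v =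
      doubleSum q (Equiv.inv _) (Equiv.refl _) δ u v := by
  classical
  set f : Perm (Fin (m + 1)) → M := fun b => if BruhatLE b v ∧ b⁻¹ (last m) = v⁻¹ (last m) ∧
    b (last m) = v (last m) then δ b else 0 with hf
  have h1 : doubleSum q (Equiv.refl _) (Equiv.inv _) δ u v =
      chainOp q (fun p => if p (last m) = v (last m) then
        autoChainOp q (Equiv.inv _) f p else 0) u := by
    rw [doubleSum, autoChainOp_refl]
    refine congrFun (congrArg (chainOp q) (funext fun p => ?_)) u
    refine ite_congr rfl (fun hp => autoChainOp_congr q isAuto_inv fun b hb _ => ?_) fun _ => rfl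
    -- The last letter weakly decreases along `p ≤ b ≤ v` and agrees at both ends, so the condition
    -- on `b` comes for free.
    refine if_congr (and_congr_right fun hbv => (and_iff_left ?_).symm) rfl rfl
    exact le_antisymm (hb.last_le.trans_eq hp) hbv.last_le
  have h2 : doubleSum q (Equiv.inv _) (Equiv.refl _) δ u v =
      autoChainOp q (Equiv.inv _) (fun p => if p⁻¹ (last m) = v⁻¹ (last m) then
        chainOp q f p else 0) u := by
    rw [doubleSum, autoChainOp_refl]
    refine congrFun (congrArg (autoChainOp q _) (funext fun p => ?_)) u
    refine ite_congr rfl (fun hp => ?_) fun _ => rfl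
    rw [← autoChainOp_refl]
    refine autoChainOp_congr q isAuto_refl fun b hb _ => ?_
    refine if_congr (and_congr_right fun hbv => (and_iff_right ?_).symm) rfl rfl
    exact le_antisymm ((isAuto_inv.le_iff.2 hb).last_le.trans_eq hp)
      (isAuto_inv.le_iff.2 hbv).last_le
  rw [h1, h2]
  -- If `v` fixes the last position, the relabelling argument does not apply, but then `f` is
  -- supported where no chain step can arrive and every operator fixes it.
  by_cases hv : v (last m) = last m
  · have hv' : v⁻¹ (last m) = last m := by rw [Perm.inv_eq_iff_eq, hv]
    have hA : chainOp q f = f := chainOp_eq_self q fun y hy =>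
      if_neg fun h => hy (h.2.2.trans hv)
    have hB : autoChainOp q (Equiv.inv _) f = f := by
      funext y
      have h : chainOp q (f ∘ Inv.inv) = f ∘ Inv.inv := chainOp_eq_self q fun y hy =>
        if_neg fun h => hy (by simpa using h.2.1.trans hv')
      refine (congrFun h y⁻¹).trans ?_
      simp
    have e1 : (fun p : Perm (Fin (m + 1)) => if p (last m) = v (last m) then f p else 0) = f := by
      funext p
      exact ite_eq_left_iff.2 fun h => (if_neg fun h' => h h'.2.2).symm
    have e2 : (fun p : Perm (Fin (m + 1)) =>
        if p⁻¹ (last m) = v⁻¹ (last m) then f p else 0) = f := by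
      funext p
      exact ite_eq_left_iff.2 fun h => (if_neg fun h' => h h'.2.1).symm
    rw [hA, hB, e1, e2, hA, hB]
  · exact chainOp_restrict_comm q hv (fun h => hv (by rw [← Perm.inv_eq_iff_eq.1 h]))
      (fun y hy => if_neg fun h => hy h.2.2) (fun y hy => if_neg fun h => hy h.2.1) u

end Hecke

/-! ### Standard minima -/

section Parabolic

variable {n m : ℕ}

open Fin (last)

theorem swap_mem_parabolic {k : ℕ} {i j : Fin n} (hij : i ≤ j)
    (h : ∀ l : Fin n, i < l → l ≤ j → (l : ℕ) ≠ k) : Equiv.swap i j ∈ parabolic n k := by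
  obtain ⟨j, hj⟩ := j
  induction j with
  | zero =>
    have : i = ⟨0, hj⟩ := le_antisymm hij (Nat.zero_le _)
    rw [this, Equiv.swap_self]
    exact one_mem _
  | succ j ih =>
    rcases hij.eq_or_lt with rfl | hlt
    · rw [Equiv.swap_self]
      exact one_mem _
    · have hle : i ≤ (⟨j, by omega⟩ : Fin n) := Nat.lt_succ_iff.1 hlt
      refine SubmonoidClass.swap_mem_trans (b := (⟨j, by omega⟩ : Fin n)) (parabolic n k)
        (ih (by omega) hle fun l h1 h2 => h l h1 (h2.trans (Nat.le_succ j))) ?_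
      exact Subgroup.subset_closure ⟨⟨j, by omega⟩, ⟨j + 1, hj⟩, rfl, h _ hlt le_rfl, rfl⟩

/-- The stabilizer of `c` is the symmetric group on the other letters, which is generated by
transpositions. -/
theorem mem_of_apply_eq_self {H : Subgroup (Perm (Fin n))} {c : Fin n}
    (hH : ∀ i j, i ≠ c → j ≠ c → Equiv.swap i j ∈ H) {w : Perm (Fin n)} (hw : w c = c) :
    w ∈ H := by
  have key : ∀ x : Perm {i // i ≠ c}, Perm.ofSubtype x ∈ H := by
    intro x
    induction x using Perm.swap_induction_on with
    | one => rw [map_one]; exact one_mem _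
    | swap_mul x i j _ ih =>
      rw [map_mul, Perm.ofSubtype_swap_eq]
      exact mul_mem (hH _ _ i.2 j.2) ih
  have h1 : ∀ i, w i ≠ c ↔ i ≠ c := fun i =>
    not_congr ⟨fun h => w.injective (h.trans hw.symm), fun h => h ▸ hw⟩
  have h2 := key (w.subtypePerm h1)
  rwa [Perm.ofSubtype_subtypePerm] at h2
  rintro i hi rfl
  exact hi hw

theorem apply_eq_self_of_mem_closure {S : Set (Perm (Fin n))} {c : Fin n}
    (hS : ∀ s ∈ S, s c = c) {w : Perm (Fin n)} (hw : w ∈ Subgroup.closure S) : w c = c := by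
  have h : Subgroup.closure S ≤ MulAction.stabilizer (Perm (Fin n)) c :=
    (Subgroup.closure_le _).2 hS
  exact h hw

theorem mem_parabolic_last {w : Perm (Fin (m + 1))} :
    w ∈ parabolic (m + 1) m ↔ w (last m) = last m := by
  constructor
  · refine apply_eq_self_of_mem_closure ?_
    rintro _ ⟨i, j, hij, hj, rfl⟩
    have := j.2
    exact Equiv.swap_apply_of_ne_of_ne (by simp [Fin.ext_iff]; omega)
      (by simp [Fin.ext_iff]; omega)
  · refine mem_of_apply_eq_self fun i j hi hj => ?_
    have h : ∀ i j : Fin (m + 1), j ≠ last m → i ≤ j → Equiv.swap i j ∈ parabolic (m + 1) m :=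
      fun i j hj hij => swap_mem_parabolic hij fun l _ hl hlm =>
        hj (le_antisymm (Fin.le_last j) ((Fin.ext hlm : l = last m) ▸ hl))
    rcases le_total i j with hij | hij
    · exact h i j hj hij
    · rw [Equiv.swap_comm]
      exact h j i hi hij

theorem mem_parabolic_one {w : Perm (Fin (m + 1))} :
    w ∈ parabolic (m + 1) 1 ↔ w 0 = 0 := by
  constructor
  · refine apply_eq_self_of_mem_closure ?_
    rintro _ ⟨i, j, hij, hj, rfl⟩
    exact Equiv.swap_apply_of_ne_of_ne (by simp [Fin.ext_iff]; omega)
      (by simp [Fin.ext_iff]; omega)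
  · refine mem_of_apply_eq_self fun i j hi hj => ?_
    have h : ∀ i j : Fin (m + 1), i ≠ 0 → i ≤ j → Equiv.swap i j ∈ parabolic (m + 1) 1 :=
      fun i j hi hij => swap_mem_parabolic hij fun l hl _ hlm => by
        have h1 : (i : ℕ) ≠ 0 := fun h => hi (Fin.ext h)
        have h2 : (i : ℕ) < l := hl
        omega
    rcases le_total i j with hij | hij
    · exact h i j hi hij
    · rw [Equiv.swap_comm]
      exact h j i hj hij

theorem exists_eq_mul_iff {G : Type*} [Group G] {H : Subgroup G} {x v : G} :
    (∃ w ∈ H, x = v * w) ↔ v⁻¹ * x ∈ H :=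
  ⟨fun ⟨w, hw, h⟩ => by rwa [h, inv_mul_cancel_left], fun h => ⟨_, h, by simp⟩⟩

theorem exists_eq_mul_iff' {G : Type*} [Group G] {H : Subgroup G} {x v : G} :
    (∃ w ∈ H, x = w * v) ↔ v * x⁻¹ ∈ H := by
  rw [← inv_mem_iff, mul_inv_rev, inv_inv]
  exact ⟨fun ⟨w, hw, h⟩ => by rwa [h, mul_inv_cancel_right], fun h => ⟨_, h, by simp⟩⟩

theorem isLastMin_auto_iff {φ : Perm (Perm (Fin (m + 1)))} (hφ : IsAuto φ)
    {u v z : Perm (Fin (m + 1))} :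
    IsLastMin (φ u) (φ v) (φ z) ↔
      IsMinimum (interval u v ∩ {x | φ x (last m) = φ v (last m)}) z := by
  have h : φ ⁻¹' (interval (φ u) (φ v)) = interval u v := by
    ext y
    exact hφ.mem_interval_iff
  rw [IsLastMin, hφ.isMinimum_iff, Set.preimage_inter, h]
  rfl

theorem isUpperStandard_last_iff {u v z : Perm (Fin (m + 1))} :
    IsUpperStandard m u v z ↔ IsLastMin u v z := by
  have h : {x | ∃ w ∈ parabolic (m + 1) m, x = v * w} = {x | x (last m) = v (last m)} := by
    ext x
    rw [Set.mem_ofPred_eq, Set.mem_ofPred_eq, exists_eq_mul_iff, mem_parabolic_last,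
      Perm.mul_apply, Perm.inv_eq_iff_eq]
  rw [IsUpperStandard, h, IsLastMin]

theorem isUpperStandard_one_iff {u v z : Perm (Fin (m + 1))} :
    IsUpperStandard 1 u v z ↔
      IsLastMin (revConj (m + 1) u) (revConj (m + 1) v) (revConj (m + 1) z) := by
  have h : {x | ∃ w ∈ parabolic (m + 1) 1, x = v * w} =
      {x | revConj (m + 1) x (last m) = revConj (m + 1) v (last m)} := by
    ext x
    rw [Set.mem_ofPred_eq, Set.mem_ofPred_eq, exists_eq_mul_iff, mem_parabolic_one,
      Perm.mul_apply, Perm.inv_eq_iff_eq, revConj_apply, revConj_apply, Fin.rev_last, Fin.rev_inj]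
  rw [IsUpperStandard, h, isLastMin_auto_iff isAuto_revConj]

theorem isLowerStandard_last_iff {u v z : Perm (Fin (m + 1))} :
    IsLowerStandard m u v z ↔ IsLastMin (Equiv.inv _ u) (Equiv.inv _ v) (Equiv.inv _ z) := by
  have h : {x | ∃ w ∈ parabolic (m + 1) m, x = w * v} =
      {x | Equiv.inv (Perm (Fin (m + 1))) x (last m) = Equiv.inv (Perm (Fin (m + 1))) v (last m)} := by
    ext x
    rw [Set.mem_ofPred_eq, Set.mem_ofPred_eq, exists_eq_mul_iff', mem_parabolic_last,
      Perm.mul_apply, ← Perm.eq_inv_iff_eq]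
    rfl
  rw [IsLowerStandard, h, isLastMin_auto_iff isAuto_inv]

theorem isLowerStandard_one_iff {u v z : Perm (Fin (m + 1))} :
    IsLowerStandard 1 u v z ↔
      IsLastMin (((Equiv.inv _).trans (revConj (m + 1))) u)
        (((Equiv.inv _).trans (revConj (m + 1))) v) (((Equiv.inv _).trans (revConj (m + 1))) z) := by
  have h : {x | ∃ w ∈ parabolic (m + 1) 1, x = w * v} =
      {x | ((Equiv.inv _).trans (revConj (m + 1))) x (last m) =
        ((Equiv.inv _).trans (revConj (m + 1))) v (last m)} := by
    ext x
    rw [Set.mem_ofPred_eq, Set.mem_ofPred_eq, exists_eq_mul_iff', mem_parabolic_one,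
      Perm.mul_apply, ← Perm.eq_inv_iff_eq, Equiv.trans_apply, Equiv.trans_apply, revConj_apply,
      revConj_apply, Fin.rev_last, Fin.rev_inj]
    rfl
  rw [IsLowerStandard, h, isLastMin_auto_iff (isAuto_inv.trans isAuto_revConj)]

theorem exists_auto_isLastMin {φ : Perm (Perm (Fin (m + 1)))} (hφ : IsAuto φ)
    {u v : Perm (Fin (m + 1))} (h : BruhatLE u v) : ∃ z, IsLastMin (φ u) (φ v) (φ z) := by
  obtain ⟨z, hz⟩ := exists_isLastMin (hφ.le_iff.2 h)
  exact ⟨φ.symm z, by simpa using hz⟩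

theorem inv_trans_revConj : (Equiv.inv _).trans (revConj n) = (revConj n).trans (Equiv.inv _) :=
  Equiv.ext fun x => revConj_inv x

end Parabolic

end SymBruhat

/-! ### The theorem -/

open SymBruhat in
theorem theorem3p2 (n : ℕ) (u v : Equiv.Perm (Fin n)) (huv : SymBruhat.BruhatLE u v) :
    ∃ zLn zL1 zUn zU1 : Equiv.Perm (Fin n),
      (SymBruhat.IsLowerStandard (n - 1) u v zLn ∧ SymBruhat.IsLowerStandard 1 u v zL1 ∧
        SymBruhat.IsUpperStandard (n - 1) u v zUn ∧ SymBruhat.IsUpperStandard 1 u v zU1) ∧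
      (SymBruhat.HasJoins u v zLn ∧ SymBruhat.HasJoins u v zL1 ∧
        SymBruhat.HasJoins u v zUn ∧ SymBruhat.HasJoins u v zU1) ∧
      SymBruhat.DS u v zLn zL1 = SymBruhat.DS u v zL1 zLn ∧
      SymBruhat.DS u v zUn zU1 = SymBruhat.DS u v zU1 zUn ∧
      SymBruhat.DS u v zLn zUn = SymBruhat.DS u v zUn zLn ∧
      SymBruhat.DS u v zU1 zL1 = SymBruhat.DS u v zL1 zU1 := by
  rcases Nat.lt_or_ge n 2 with hn | hn
  -- For `n ≤ 1` there is only one permutation, and all four minima are `v`.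
  · have : Subsingleton (Fin n) := Fin.subsingleton_iff_le_one.2 (by omega)
    have hle : ∀ x y : Equiv.Perm (Fin n), BruhatLE x y := fun x y =>
      Subsingleton.elim x y ▸ BruhatLE.refl x
    have hmin : ∀ (A : Set (Equiv.Perm (Fin n))) z, z ∈ A → IsMinimum A z :=
      fun A z hz => ⟨hz, fun x _ => hle z x⟩
    have hint : ∀ x y w : Equiv.Perm (Fin n), w ∈ interval x y := fun x y w => ⟨hle _ _, hle _ _⟩
    have hL : ∀ k, IsLowerStandard k u v v := fun k =>
      hmin _ _ ⟨hint _ _ _, 1, one_mem _, (one_mul v).symm⟩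
    have hU : ∀ k, IsUpperStandard k u v v := fun k =>
      hmin _ _ ⟨hint _ _ _, 1, one_mem _, (mul_one v).symm⟩
    have hJ : HasJoins u v v := fun x _ => ⟨v, hmin _ _ ⟨hint _ _ _, hint _ _ _⟩⟩
    exact ⟨v, v, v, v, ⟨hL _, hL _, hU _, hU _⟩, ⟨hJ, hJ, hJ, hJ⟩, rfl, rfl, rfl, rfl⟩
  obtain ⟨m, rfl⟩ := Nat.exists_eq_add_of_le' hn
  have hL1 := isAuto_inv.trans (isAuto_revConj (n := m + 2))
  obtain ⟨zUn, hzUn⟩ := exists_auto_isLastMin isAuto_refl huv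
  obtain ⟨zU1, hzU1⟩ := exists_auto_isLastMin isAuto_revConj huv
  obtain ⟨zLn, hzLn⟩ := exists_auto_isLastMin isAuto_inv huv
  obtain ⟨zL1, hzL1⟩ := exists_auto_isLastMin hL1 huv
  refine ⟨zLn, zL1, zUn, zU1, ⟨isLowerStandard_last_iff.2 hzLn, isLowerStandard_one_iff.2 hzL1,
    isUpperStandard_last_iff.2 hzUn, isUpperStandard_one_iff.2 hzU1⟩,
    ⟨hzLn.hasJoins isAuto_inv, hzL1.hasJoins hL1, hzUn.hasJoins isAuto_refl,
      hzU1.hasJoins isAuto_revConj⟩, ?_, ?_, ?_, ?_⟩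
  -- Inversion carries this pair to the pair of first and last position.
  · rw [DS_eq_doubleSum isAuto_inv hL1 hzLn hzL1, DS_eq_doubleSum hL1 isAuto_inv hzL1 hzLn]
    have h1 := doubleSum_trans (shift _) (isAuto_inv (n := m + 2)) (Equiv.refl _) (revConj _)
      (fun b => {(0, b)}) u v
    have h2 := doubleSum_trans (shift _) (isAuto_inv (n := m + 2)) (revConj _) (Equiv.refl _)
      (fun b => {(0, b)}) u v
    rw [Equiv.trans_refl] at h1 h2
    rw [h1, h2, doubleSum_revConj]
  · rw [DS_eq_doubleSum isAuto_refl isAuto_revConj hzUn hzU1,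
      DS_eq_doubleSum isAuto_revConj isAuto_refl hzU1 hzUn, doubleSum_revConj]
  · rw [DS_eq_doubleSum isAuto_inv isAuto_refl hzLn hzUn,
      DS_eq_doubleSum isAuto_refl isAuto_inv hzUn hzLn, doubleSum_inv]
  -- Inversion commutes with conjugation by the longest element, and the latter carries this pair to
  -- the preceding one.
  · rw [DS_eq_doubleSum isAuto_revConj hL1 hzU1 hzL1, DS_eq_doubleSum hL1 isAuto_revConj hzL1 hzU1,
      inv_trans_revConj]
    have h1 := doubleSum_trans (shift _) (isAuto_revConj (n := m + 2)) (Equiv.refl _)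
      (Equiv.inv _) (fun b => {(0, b)}) u v
    have h2 := doubleSum_trans (shift _) (isAuto_revConj (n := m + 2)) (Equiv.inv _)
      (Equiv.refl _) (fun b => {(0, b)}) u v
    rw [Equiv.trans_refl] at h1 h2
    rw [h1, h2, doubleSum_inv]
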